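/- Let $\mathcal S,\mathcal X,\mathcal Y,\mathcal Z$ be finite alphabets, $p(s)$ a distribution on $\mathcal S$ and $p(y,z|x,s)$ a discrete memoryless state-dependent channel with input $x\in\mathcal X$, state $s\in\mathcal S$ and outputs $y\in\mathcal Y$ (legitimate receiver) and $z\in\mathcal Z$ (eavesdropper). The state sequence $S^n$ is i.i.d. with law $p(s)$ and known non-causally to the encoder, which is an arbitrary, possibly randomized, map: a conditional distribution $p(x^n|s^n)$. Given $X^n=x^n$ and $S^n=s^n$, the outputs have law $\prod_{i=1}^n p(y_i,z_i|x_i,s_i)$. A pair $(R_a,R_l)\in\mathbb R^2$ is achievable if for every $\epsilon>0$ and all sufficiently large $n$ there is an encoder with $$\tfrac1n I(S^n;Y^n)\ge R_a-\epsilon,\qquad \tfrac1n I(S^n;Z^n)\le R_l+\epsilon .$$ Let $\mathcal C$ be the set of all achievable pairs. Let $\mathcal R^4$ be the closure of the union of all pairs $(R_a,R_l)\in\mathbb R^2$ for which there is a real $R_u\ge 0$ with $$R_a\le I(S;Y,U)+R_u,$$ $$R_l\ge\min\bigl\{I(U,S;Z),\ I(S;Z,U)+\min\{R_u,[I(U;Z)-I(U;S)]^+\}\bigr\},$$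 $$R_u\le\min\{I(U;Y)-I(U;S),\ H(S|Y,U)\},$$ the union being over all finite alphabets $\mathcal U$ and all conditional distributions $p(u,x|s)$ on $\mathcal U\times\mathcal X$ such that, under the joint law $p(s)p(u,x|s)p(y,z|x,s)$, $I(U;Y)\ge I(U;S)$ and $I(U;Y)\ge I(U;Z)$. Here $[a]^+=\max\{a,0\}$ and all information quantities are in bits. Theorem. For every $p(s)$ and every channel $p(y,z|x,s)$, $\mathcal R^4\subseteq\mathcal C$. -/

import Mathlib

namespace StateChannel

noncomputable section

/-- The product law `∏ i, p i` on tuples: independent coordinates, the `i`-th one with law `p i`. -/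
def productLaw {n : ℕ} {A : Type*} [Fintype A] (p : Fin n → PMF A) : PMF (Fin n → A) :=
  PMF.ofFintype (fun a => ∏ i, p i (a i)) (by
    rw [← Fintype.prod_sum (fun i a => p i a)]
    refine Finset.prod_eq_one fun i _ => ?_
    exact (tsum_fintype (p i)).symm.trans (p i).tsum_coe)

/-- Shannon entropy `H(A)`, in bits, of a random variable `A` with finitely many values on the
discrete probability space `(Ω, p)`. -/
def entropy {Ω α : Type*} [Fintype α] (p : PMF Ω) (A : Ω → α) : ℝ :=
  ∑ a, -((p.map A a).toReal * Real.logb 2 (p.map A a).toReal)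

/-- Conditional entropy `H(A|B) = H(A,B) - H(B)`, in bits. -/
def condEntropy {Ω α β : Type*} [Fintype α] [Fintype β] (p : PMF Ω) (A : Ω → α) (B : Ω → β) : ℝ :=
  entropy p (fun ω => (A ω, B ω)) - entropy p B

/-- Mutual information `I(A;B) = H(A) + H(B) - H(A,B)`, in bits. -/
def mutualInfo {Ω α β : Type*} [Fintype α] [Fintype β] (p : PMF Ω) (A : Ω → α) (B : Ω → β) : ℝ :=
  entropy p A + entropy p B - entropy p (fun ω => (A ω, B ω))

/-- The values of the single-letter random variables `S, U, X, Y, Z`. -/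
structure Letters (S U X Y Z : Type*) where
  s : S
  u : U
  x : X
  y : Y
  z : Z

/-- The values of the block random variables `Sⁿ, Xⁿ, Yⁿ, Zⁿ`. -/
structure Blocks (n : ℕ) (S X Y Z : Type*) where
  s : Fin n → S
  x : Fin n → X
  y : Fin n → Y
  z : Fin n → Z

/-- The single-letter joint law `p(s) p(u,x|s) p(y,z|x,s)`. -/
def singleLetterLaw {S U X Y Z : Type*} (pS : PMF S) (W : X → S → PMF (Y × Z))
    (q : S → PMF (U × X)) : PMF (Letters S U X Y Z) :=
  pS.bind fun s => (q s).bind fun ux => (W ux.2 s).map fun yz => ⟨s, ux.1, ux.2, yz.1, yz.2⟩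

/-- The joint law of `(Sⁿ, Xⁿ, Yⁿ, Zⁿ)` when the state sequence is i.i.d. with law `pS`, the
(possibly randomized) encoder `f` sees the whole state sequence and emits `Xⁿ` with law `f sⁿ`,
and the channel `W` is used `n` times without memory. -/
def blockLaw {S X Y Z : Type*} [Fintype S] [Fintype Y] [Fintype Z]
    (pS : PMF S) (W : X → S → PMF (Y × Z)) {n : ℕ}
    (f : (Fin n → S) → PMF (Fin n → X)) : PMF (Blocks n S X Y Z) :=
  (productLaw fun _ : Fin n => pS).bind fun s =>
    (f s).bind fun x =>
      (productLaw fun i => W (x i) (s i)).map fun yz =>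
        ⟨s, x, fun i => (yz i).1, fun i => (yz i).2⟩

/-- `(R_a, R_l)` is achievable: for every `ε > 0` and every sufficiently large `n` there is an
encoder of block length `n` with `I(Sⁿ;Yⁿ)/n ≥ R_a - ε` and `I(Sⁿ;Zⁿ)/n ≤ R_l + ε`. -/
def Achievable {S X Y Z : Type*} [Fintype S] [Fintype Y] [Fintype Z]
    (pS : PMF S) (W : X → S → PMF (Y × Z)) (Ra Rl : ℝ) : Prop :=
  ∀ ε : ℝ, 0 < ε → ∃ N : ℕ, ∀ n : ℕ, N ≤ n → ∃ f : (Fin n → S) → PMF (Fin n → X),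
    Ra - ε ≤ 1 / (n : ℝ) * mutualInfo (blockLaw pS W f) Blocks.s Blocks.y ∧
    1 / (n : ℝ) * mutualInfo (blockLaw pS W f) Blocks.s Blocks.z ≤ Rl + ε

/-- The trade-off region `𝒞`: all achievable pairs `(R_a, R_l)`. -/
def tradeoffRegion {S X Y Z : Type*} [Fintype S] [Fintype Y] [Fintype Z]
    (pS : PMF S) (W : X → S → PMF (Y × Z)) : Set (ℝ × ℝ) :=
  {R | Achievable pS W R.1 R.2}

/-- The pairs `(R_a, R_l)` that satisfy the rate conditions of secure refinement for the law `P` of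
`(S,U,X,Y,Z)` and the refinement rate `R_u`. -/
def SecureRefinementRates {S U X Y Z : Type*} [Fintype S] [Fintype U] [Fintype Y] [Fintype Z]
    (P : PMF (Letters S U X Y Z)) (Ru Ra Rl : ℝ) : Prop :=
  0 ≤ Ru ∧
  Ra ≤ mutualInfo P Letters.s (fun ω => (ω.y, ω.u)) + Ru ∧
  Rl ≥ min (mutualInfo P (fun ω => (ω.u, ω.s)) Letters.z)
    (mutualInfo P Letters.s (fun ω => (ω.z, ω.u)) +
      min Ru (max (mutualInfo P Letters.u Letters.z - mutualInfo P Letters.u Letters.s) 0)) ∧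
  Ru ≤ min (mutualInfo P Letters.u Letters.y - mutualInfo P Letters.u Letters.s)
    (condEntropy P Letters.s (fun ω => (ω.y, ω.u)))

/-- The region `ℛ⁴`: the closure of the union of these pairs over all finite auxiliary alphabets
`{0, …, k-1}` for `U` and all conditional laws `p(u,x|s)` with `I(U;Y) ≥ I(U;S)` and
`I(U;Y) ≥ I(U;Z)`. -/
def secureRefinementRegion {S X Y Z : Type*} [Fintype S] [Fintype Y] [Fintype Z]
    (pS : PMF S) (W : X → S → PMF (Y × Z)) : Set (ℝ × ℝ) :=
  closure {R | ∃ (k : ℕ) (q : S → PMF (Fin k × X)),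
    let P := singleLetterLaw pS W q
    mutualInfo P Letters.u Letters.y ≥ mutualInfo P Letters.u Letters.s ∧
    mutualInfo P Letters.u Letters.y ≥ mutualInfo P Letters.u Letters.z ∧
    ∃ Ru : ℝ, SecureRefinementRates P Ru R.1 R.2}

end

end StateChannel

namespace StateChannel

/-! Fix a law p(s)p(u,x|s) and a refinement rate R_u. Draw codewords i.i.d. from the law of U^n and
give each a random set of accepted states: u^n accepts s^n with probability p(u^n|s^n)/(M p(u^n)),
where M = 2^{n(I(U;S)+R_u+δ)}, and never if this ratio exceeds 1. The encoder takes the first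
codeword that accepts s^n and sends X^n by the law of X given (U,S). This is rejection sampling: the
codeword sent has nearly the law p(u^n|s^n), and with N ≈ M 2^{nδ} codewords failure is rare
(`codebook_average_le`).

Receiver Y. For a transmitted pair (s^n,u^n), the mean over codebooks of the induced law of Y^n is
dominated by three contributions: the state itself, p(s^n)p(y^n|s^n,u^n); the other states sharing
the codeword, p(y^n|u^n)/M; the states that use other codewords or fail, a multiple of p(y^n). This
is `codebook_output_ratio_le`. Relative to p(y^n|s^n,u^n) their exponents are H(S), I(S;Y,U)+R_u and
I(U,S;Y), up to δ, so I(S^n;Y^n)/n is nearly at least the smallest of them (`le_channelInfo_code`).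
The two upper bounds on R_u say exactly that I(S;Y,U)+R_u is the smallest.

Receiver Z. Any reference law Q bounds the information from above by a mean log-ratio
(`channelInfo_code_le`). The product law of Z^n gives I(U,S;Z); the uniform mixture of p(z^n|u^n)
over the codebook gives I(S;Z,U)+R_u. Since I(S;Z,U)+I(U;Z)-I(U;S) = I(U,S;Z), these two cover the
minimum in the rate condition.

Only first moments are used: the log-densities deviate by O(√n) in mean, and failure costs O(n) with
probability O(1/√n). `exists_code` puts all requirements into one expectation, and
`exists_code_bounds` evaluates the result. -/

/-! ### Sums over tuples, Gibbs' inequality, mean deviations -/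

theorem sum_tuple_prod {ι A : Type*} [Fintype ι] [DecidableEq ι] [Fintype A] (f : ι → A → ℝ) :
    ∑ x : ι → A, ∏ i, f i (x i) = ∏ i, ∑ a, f i a := by
  exact (Fintype.prod_sum f).symm

theorem logb_two_sub_le {a b : ℝ} (ha : 0 < a) (hb : 0 < b) :
    Real.logb 2 a - Real.logb 2 b ≤ (a / b - 1) / Real.log 2 := by
  have h2 : 0 < Real.log 2 := Real.log_pos (by norm_num)
  rw [Real.logb, Real.logb, ← sub_div, ← Real.log_div ha.ne' hb.ne']
  gcongr
  exact Real.log_le_sub_one_of_pos (div_pos ha hb)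

/-- Follows from log t ≤ t - 1 at t = Q/P. Total mass of Q at most one suffices, as for the
reference law `codebookOutput`. -/
theorem gibbs_inequality {B : Type*} [Fintype B] (P Q : B → ℝ) (hP : ∀ b, 0 ≤ P b)
    (hQ : ∀ b, 0 ≤ Q b) (hP1 : ∑ b, P b = 1) (hQ1 : ∑ b, Q b ≤ 1)
    (hac : ∀ b, 0 < P b → 0 < Q b) :
    ∑ b, P b * Real.logb 2 (Q b) ≤ ∑ b, P b * Real.logb 2 (P b) := by
  have h2 : 0 < Real.log 2 := Real.log_pos (by norm_num)
  have key : ∀ b, P b * Real.logb 2 (Q b) - P b * Real.logb 2 (P b)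
      ≤ (Q b - P b) / Real.log 2 := by
    intro b
    rcases (hP b).eq_or_lt with h | h
    · rw [← h]; simp only [zero_mul, sub_zero]
      exact div_nonneg (hQ b) h2.le
    · have := mul_le_mul_of_nonneg_left (logb_two_sub_le (hac b h) h) h.le
      have e : P b * ((Q b / P b - 1) / Real.log 2) = (Q b - P b) / Real.log 2 := by
        field_simp
      linarith
  have := Finset.sum_le_sum fun b (_ : b ∈ Finset.univ) => key b
  rw [Finset.sum_sub_distrib, ← Finset.sum_div, Finset.sum_sub_distrib, hP1] at this
  have h3 : (∑ b, Q b - 1) / Real.log 2 ≤ 0 := div_nonpos_of_nonpos_of_nonneg (by linarith) h2.le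
  linarith

/-- Variance of a sum of independent centred variables: the cross terms factor over the coordinates
and vanish. -/
theorem sum_prod_mul_sq_sum_le {R : Type*} [Fintype R] (w g : R → ℝ) (hw : ∀ r, 0 ≤ w r)
    (hw1 : ∑ r, w r = 1) (hg : ∑ r, w r * g r = 0) {B : ℝ} (hB : ∀ r, |g r| ≤ B) (n : ℕ) :
    ∑ r : Fin n → R, (∏ i, w (r i)) * (∑ i, g (r i)) ^ 2 ≤ n * B ^ 2 := by
  have hone : ∑ r : Fin n → R, ∏ i, w (r i) = 1 := by
    rw [sum_tuple_prod (fun _ => w)]; simp [hw1]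
  have hsplit : ∑ r : Fin n → R, (∏ i, w (r i)) * (∑ i, g (r i)) ^ 2
      = ∑ i, ∑ j, ∑ r : Fin n → R, (∏ k, w (r k)) * (g (r i) * g (r j)) := by
    simp_rw [sq, Finset.sum_mul_sum, Finset.mul_sum]
    rw [Finset.sum_comm]
    exact Finset.sum_congr rfl fun i _ => Finset.sum_comm
  have hcross : ∀ i j : Fin n, ∑ r : Fin n → R, (∏ k, w (r k)) * (g (r i) * g (r j))
      ≤ if i = j then B ^ 2 else 0 := by
    intro i j
    split_ifs with hij
    · subst hij
      calc _ ≤ ∑ r : Fin n → R, (∏ k, w (r k)) * B ^ 2 := by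
            refine Finset.sum_le_sum fun r _ => mul_le_mul_of_nonneg_left ?_
              (Finset.prod_nonneg fun k _ => hw _)
            rw [← sq, ← sq_abs]
            exact pow_le_pow_left₀ (abs_nonneg _) (hB _) 2
        _ = B ^ 2 := by rw [← Finset.sum_mul, hone, one_mul]
    · apply le_of_eq
      have e : ∀ r : Fin n → R, (∏ k, w (r k)) * (g (r i) * g (r j))
          = ∏ k, (w (r k) * ((if k = i then g (r k) else 1) * (if k = j then g (r k) else 1))) := by
        intro r
        rw [Finset.prod_mul_distrib, Finset.prod_mul_distrib]
        simp
      simp_rw [e]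
      rw [sum_tuple_prod (fun k a => w a * ((if k = i then g a else 1) * (if k = j then g a else 1)))]
      refine Finset.prod_eq_zero (Finset.mem_univ i) ?_
      simpa [hij] using hg
  rw [hsplit]
  calc _ ≤ ∑ i : Fin n, ∑ j : Fin n, (if i = j then B ^ 2 else 0) :=
        Finset.sum_le_sum fun i _ => Finset.sum_le_sum fun j _ => hcross i j
    _ = n * B ^ 2 := by simp

/-- Mean absolute deviation of a sum of independent identically distributed variables. -/
theorem sum_prod_mul_abs_sum_sub_le {R : Type*} [Fintype R] (w f : R → ℝ) (hw : ∀ r, 0 ≤ w r)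
    (hw1 : ∑ r, w r = 1) {m B : ℝ} (hm : ∑ r, w r * f r = m) (hB : ∀ r, |f r - m| ≤ B) (hB0 : 0 ≤ B)
    (n : ℕ) :
    ∑ r : Fin n → R, (∏ i, w (r i)) * |∑ i, f (r i) - n * m| ≤ B * Real.sqrt n := by
  have hone : ∑ r : Fin n → R, ∏ i, w (r i) = 1 := by
    rw [sum_tuple_prod (fun _ => w)]; simp [hw1]
  have hsq := sum_prod_mul_sq_sum_le w (fun r => f r - m) hw hw1
    (by simp_rw [mul_sub]; rw [Finset.sum_sub_distrib, ← Finset.sum_mul, hw1, hm]; ring) hB n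
  have hW : ∀ r : Fin n → R, 0 ≤ ∏ i, w (r i) := fun r => Finset.prod_nonneg fun k _ => hw _
  -- Cauchy–Schwarz with the weight split into two square roots turns the variance bound into a
  -- first-moment bound.
  have hcs := Finset.sum_mul_sq_le_sq_mul_sq Finset.univ
    (fun r : Fin n → R => Real.sqrt (∏ i, w (r i)))
    (fun r : Fin n → R => Real.sqrt (∏ i, w (r i)) * |∑ i, f (r i) - n * m|)
  have e1 : ∀ r : Fin n → R, Real.sqrt (∏ i, w (r i)) *
      (Real.sqrt (∏ i, w (r i)) * |∑ i, f (r i) - n * m|)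
      = (∏ i, w (r i)) * |∑ i, f (r i) - n * m| := by
    intro r; rw [← mul_assoc, Real.mul_self_sqrt (hW r)]
  have e2 : ∀ r : Fin n → R, (Real.sqrt (∏ i, w (r i)) * |∑ i, f (r i) - n * m|) ^ 2
      = (∏ i, w (r i)) * (∑ i, (f (r i) - m)) ^ 2 := by
    intro r
    rw [mul_pow, Real.sq_sqrt (hW r), sq_abs, Finset.sum_sub_distrib]; simp
  simp_rw [e1, e2, fun r : Fin n → R => Real.sq_sqrt (hW r)] at hcs
  rw [hone, one_mul] at hcs
  refine abs_le_of_sq_le_sq' ?_ (by positivity) |>.2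
  rw [mul_pow, Real.sq_sqrt (Nat.cast_nonneg n)]
  linarith

/-- The mean absolute deviation bound for three coordinates with law `p(s) κ(s,u) V(s,u,b)`. -/
theorem sum_abs_dev_triple_le {S U B : Type*} [Fintype S] [Fintype U] [Fintype B]
    (p : S → ℝ) (κ : S → U → ℝ) (V : S → U → B → ℝ) (f : S → U → B → ℝ)
    (hw : ∀ s u b, 0 ≤ p s * κ s u * V s u b)
    (hw1 : ∑ s, ∑ u, ∑ b, p s * κ s u * V s u b = 1) {m C : ℝ}
    (hm : ∑ s, ∑ u, ∑ b, p s * κ s u * V s u b * f s u b = m)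
    (hC : ∀ s u b, |f s u b - m| ≤ C) (hC0 : 0 ≤ C) (n : ℕ) :
    ∑ s : Fin n → S, ∑ u : Fin n → U, ∑ b : Fin n → B,
      (∏ i, p (s i)) * (∏ i, κ (s i) (u i)) * (∏ i, V (s i) (u i) (b i)) *
        |∑ i, f (s i) (u i) (b i) - n * m| ≤ C * Real.sqrt n := by
  have h := sum_prod_mul_abs_sum_sub_le (R := S × U × B)
    (fun r => p r.1 * κ r.1 r.2.1 * V r.1 r.2.1 r.2.2) (fun r => f r.1 r.2.1 r.2.2)
    (fun r => hw _ _ _) (by simpa [Fintype.sum_prod_type] using hw1)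
    (by simpa [Fintype.sum_prod_type] using hm) (fun r => hC _ _ _) hC0 n
  refine le_trans (le_of_eq ?_) h
  let e : ((Fin n → S) × (Fin n → U) × (Fin n → B)) ≃ (Fin n → S × U × B) :=
    { toFun := fun x i => (x.1 i, x.2.1 i, x.2.2 i)
      invFun := fun r => (fun i => (r i).1, fun i => (r i).2.1, fun i => (r i).2.2)
      left_inv := fun _ => rfl
      right_inv := fun _ => rfl }
  rw [← e.sum_comp]
  simp only [Fintype.sum_prod_type, e, Equiv.coe_fn_mk, Finset.prod_mul_distrib]

/-! ### First accepted entry of an independent codebook -/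

section FirstAccepted

variable {C : Type*} {N : ℕ}

/-- As a product over entries, the event lets expectations over an independent codebook factor. -/
theorem indicator_find_eq_some (A : C → Bool) (c : Fin N → C) (t : Fin N) :
    (if Fin.find? (fun i => A (c i)) = some t then (1 : ℝ) else 0) =
      ∏ i, (if i < t then (if A (c i) then 0 else 1)
        else if i = t then (if A (c i) then 1 else 0) else 1) := by
  split_ifs with h
  · rw [Fin.find?_eq_some_iff] at h
    symm
    refine Finset.prod_eq_one fun i _ => ?_
    split_ifs with h1 h2 h3 h4
    · simp [h.2 i h1] at h2
    · rfl
    · rfl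
    · subst h3; exact absurd h.1 h4
    · rfl
  · rw [Fin.find?_eq_some_iff, not_and_or] at h
    symm
    rcases h with h | h
    · exact Finset.prod_eq_zero (Finset.mem_univ t) (by simp [h])
    · push Not at h
      obtain ⟨j, hj, hA⟩ := h
      exact Finset.prod_eq_zero (Finset.mem_univ j) (by simp [hj, hA])

theorem indicator_find_eq_none (A : C → Bool) (c : Fin N → C) :
    (if Fin.find? (fun i => A (c i)) = none then (1 : ℝ) else 0) =
      ∏ i, (if A (c i) then (0 : ℝ) else 1) := by
  split_ifs with h
  · rw [Fin.find?_eq_none_iff] at h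
    symm
    exact Finset.prod_eq_one fun i _ => by simp [h i]
  · rw [Fin.find?_eq_none_iff] at h
    push Not at h
    obtain ⟨j, hA⟩ := h
    symm
    exact Finset.prod_eq_zero (Finset.mem_univ j) (by simp [hA])

theorem sum_find_eq_none [Fintype C] (m : C → ℝ) (A : C → Bool) :
    ∑ c : Fin N → C, (∏ i, m (c i)) *
      (if Fin.find? (fun i => A (c i)) = none then (1 : ℝ) else 0) =
      (∑ x, m x * (if A x then 0 else 1)) ^ N := by
  simp_rw [indicator_find_eq_none, ← Finset.prod_mul_distrib]
  rw [sum_tuple_prod (fun _ x => m x * (if A x then 0 else 1))]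
  simp

theorem sum_find_eq_some [Fintype C] (m : C → ℝ) (hm : ∑ x, m x = 1) (A : C → Bool) (h : C → ℝ) (t : Fin N) :
    ∑ c : Fin N → C, (∏ i, m (c i)) *
      ((if Fin.find? (fun i => A (c i)) = some t then (1 : ℝ) else 0) * h (c t)) =
      (∑ x, m x * (if A x then 0 else 1)) ^ (t : ℕ) * ∑ x, m x * ((if A x then 1 else 0) * h x) := by
  have e : ∀ c : Fin N → C, h (c t) = ∏ i, (if i = t then h (c i) else 1) := by
    intro c; simp
  simp_rw [indicator_find_eq_some, e, ← Finset.prod_mul_distrib]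
  rw [sum_tuple_prod (fun i x => m x * ((if i < t then (if A x then 0 else 1)
        else if i = t then (if A x then 1 else 0) else 1) * (if i = t then h x else 1)))]
  have e2 : ∀ i : Fin N, ∑ x, m x * ((if i < t then (if A x then 0 else 1)
        else if i = t then (if A x then 1 else 0) else 1) * (if i = t then h x else 1)) =
      (if i < t then ∑ x, m x * (if A x then 0 else 1) else 1) *
      (if i = t then ∑ x, m x * ((if A x then 1 else 0) * h x) else 1) := by
    intro i
    rcases lt_trichotomy i t with h1 | h1 | h1
    · simp [h1, h1.ne]
    · subst h1; simp
    · simp [h1.ne', not_lt.2 h1.le, hm]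
  simp_rw [e2, Finset.prod_mul_distrib]
  congr 1
  · rw [Finset.prod_ite, Finset.prod_const, Finset.prod_const_one, mul_one]
    congr 1
    have : Finset.filter (fun x => x < t) Finset.univ = Finset.Iio t := by ext; simp
    rw [this, Fin.card_Iio]
  · simp

/-- First acceptance at t conditions each earlier entry on rejection, an event of probability at
least 1/2, so the mean of b there grows by at most a factor 2. Later entries are unconditioned. -/
theorem sum_find_eq_some_mul_le [Fintype C] (m : C → ℝ) (hm0 : ∀ x, 0 ≤ m x) (hm : ∑ x, m x = 1)
    (A : C → Bool) (hA : 1 / 2 ≤ ∑ x, m x * (if A x then 0 else 1)) (h b : C → ℝ)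
    (hh : ∀ x, 0 ≤ h x) (hb : ∀ x, 0 ≤ b x) (t t' : Fin N) (htt : t' ≠ t) :
    ∑ c : Fin N → C, (∏ i, m (c i)) *
      ((if Fin.find? (fun i => A (c i)) = some t then (1 : ℝ) else 0) * h (c t) * b (c t')) ≤
    2 * (∑ x, m x * b x) * ∑ c : Fin N → C, (∏ i, m (c i)) *
      ((if Fin.find? (fun i => A (c i)) = some t then (1 : ℝ) else 0) * h (c t)) := by
  have e : ∀ c : Fin N → C, h (c t) = ∏ i, (if i = t then h (c i) else 1) := by
    intro c; simp
  have eb : ∀ c : Fin N → C, b (c t') = ∏ i, (if i = t' then b (c i) else 1) := by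
    intro c; simp
  simp_rw [indicator_find_eq_some, e, eb, ← Finset.prod_mul_distrib]
  rw [sum_tuple_prod (fun i x => m x * ((if i < t then (if A x then 0 else 1)
        else if i = t then (if A x then 1 else 0) else 1) * (if i = t then h x else 1))),
    sum_tuple_prod (fun i x => m x * ((if i < t then (if A x then 0 else 1)
        else if i = t then (if A x then 1 else 0) else 1) * (if i = t then h x else 1) *
        (if i = t' then b x else 1)))]
  have e3 : 2 * (∑ x, m x * b x) = ∏ i : Fin N, (if i = t' then 2 * (∑ x, m x * b x) else 1) := by
    simp
  have hb' : 0 ≤ ∑ x, m x * b x := Finset.sum_nonneg fun x _ => mul_nonneg (hm0 x) (hb x)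
  rw [e3, ← Finset.prod_mul_distrib]
  refine Finset.prod_le_prod (fun i _ => Finset.sum_nonneg fun x _ => ?_) fun i _ => ?_
  · refine mul_nonneg (hm0 x) (mul_nonneg (mul_nonneg ?_ ?_) ?_) <;> split_ifs <;>
      first | exact hh x | exact hb x | norm_num
  · by_cases hi : i = t'
    · subst hi
      rcases lt_or_gt_of_ne htt with h1 | h1
      · simp only [h1, if_true, h1.ne, if_false, mul_one]
        have h2 : ∑ x, m x * ((if A x then 0 else 1) * b x) ≤ ∑ x, m x * b x := by
          refine Finset.sum_le_sum fun x _ => mul_le_mul_of_nonneg_left ?_ (hm0 x)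
          have := hb x
          split_ifs <;> simp [this]
        nlinarith
      · simp only [not_lt.2 h1.le, htt, if_true, if_false, mul_one, one_mul, hm]
        linarith
    · simp [hi]

end FirstAccepted

/-! ### Random codebooks with random acceptance sets -/

section Entries

variable {S U : Type*} [Fintype S]

/-- Law of a codebook entry: a codeword of law `w` with an acceptance set that contains each `s`
independently with probability `α s u`. -/
def entryWeight (w : U → ℝ) (α : S → U → ℝ) (x : U × (S → Bool)) : ℝ :=
  w x.1 * ∏ s, (if x.2 s then α s x.1 else 1 - α s x.1)

variable (w : U → ℝ) (α : S → U → ℝ)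

theorem entryWeight_nonneg (hw : ∀ u, 0 ≤ w u) (h0 : ∀ s u, 0 ≤ α s u) (h1 : ∀ s u, α s u ≤ 1)
    (x : U × (S → Bool)) : 0 ≤ entryWeight w α x := by
  refine mul_nonneg (hw _) (Finset.prod_nonneg fun s _ => ?_)
  split_ifs
  · exact h0 _ _
  · linarith [h1 s x.1]

theorem sum_entryWeight [Fintype U] [DecidableEq S] (g : U → ℝ) :
    ∑ x, entryWeight w α x * g x.1 = ∑ u, w u * g u := by
  rw [Fintype.sum_prod_type]
  refine Finset.sum_congr rfl fun u _ => ?_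
  simp only [entryWeight, ← Finset.sum_mul, ← Finset.mul_sum]
  rw [sum_tuple_prod (fun s (b : Bool) => (if b then α s u else 1 - α s u))]
  simp

theorem sum_entryWeight_accept [Fintype U] [DecidableEq S] (s₀ : S) (g : U → ℝ) :
    ∑ x, entryWeight w α x * ((if x.2 s₀ then 1 else 0) * g x.1) =
      ∑ u, w u * (α s₀ u * g u) := by
  rw [Fintype.sum_prod_type]
  refine Finset.sum_congr rfl fun u _ => ?_
  have e : ∀ a : S → Bool, (if a s₀ then (1 : ℝ) else 0) =
      ∏ s, (if s = s₀ then (if a s then 1 else 0) else 1) := by intro a; simp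
  simp only [entryWeight, ← mul_assoc, ← Finset.sum_mul]
  simp only [e, mul_assoc, ← Finset.mul_sum, ← Finset.prod_mul_distrib]
  rw [sum_tuple_prod (fun s (b : Bool) => (if b then α s u else 1 - α s u) *
    (if s = s₀ then (if b then 1 else 0) else 1))]
  simp

/-- Given the codeword, distinct states are accepted independently. This decouples the transmitted
state from the others that share its codeword. -/
theorem sum_entryWeight_accept_accept [Fintype U] [DecidableEq S] (s₀ s₁ : S)
    (hs : s₁ ≠ s₀) (g : U → ℝ) :
    ∑ x, entryWeight w α x * ((if x.2 s₀ then 1 else 0) * (if x.2 s₁ then 1 else 0) * g x.1) =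
      ∑ u, w u * (α s₀ u * α s₁ u * g u) := by
  rw [Fintype.sum_prod_type]
  refine Finset.sum_congr rfl fun u _ => ?_
  have e : ∀ (a : S → Bool) (s₀ : S), (if a s₀ then (1 : ℝ) else 0) =
      ∏ s, (if s = s₀ then (if a s then 1 else 0) else 1) := by intro a s₀; simp
  simp only [entryWeight, ← mul_assoc, ← Finset.sum_mul]
  simp only [e _ s₀, e _ s₁, mul_assoc, ← Finset.mul_sum, ← Finset.prod_mul_distrib]
  rw [sum_tuple_prod (fun s (b : Bool) => (if b then α s u else 1 - α s u) *
    ((if s = s₀ then (if b then 1 else 0) else 1) * (if s = s₁ then (if b then 1 else 0) else 1)))]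
  have e2 : ∀ s, ∑ b : Bool, (if b then α s u else 1 - α s u) *
    ((if s = s₀ then (if b then 1 else 0) else 1) * (if s = s₁ then (if b then 1 else 0) else 1)) =
      (if s = s₀ then α s u else 1) * (if s = s₁ then α s u else 1) := by
    intro s
    by_cases h : s = s₀
    · subst h; simp [hs.symm]
    · by_cases h' : s = s₁ <;> simp [h, h', hs]
  rw [Finset.prod_congr rfl fun s _ => e2 s, Finset.prod_mul_distrib]
  simp [mul_assoc]

theorem accept_pos_of_entryWeight_pos (h0 : ∀ s u, 0 ≤ α s u)
    (x : U × (S → Bool)) (hx : 0 < entryWeight w α x) (s : S) (hs : x.2 s = true) :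
    0 < α s x.1 := by
  refine lt_of_le_of_ne (h0 _ _) fun h => hx.ne' ?_
  rw [entryWeight, Finset.prod_eq_zero (Finset.mem_univ s) (by simp [hs, ← h]), mul_zero]

end Entries

noncomputable section

/-! ### Random codes by rejection sampling -/

section RandomCoding

variable {S U Y : Type*} [Fintype S]

/-- Law of the codeword letter. -/
def inputLaw (p : S → ℝ) (κ : S → U → ℝ) (u : U) : ℝ := ∑ s, p s * κ s u

/-- Joint law of codeword and output. -/
def inputOutputLaw (p : S → ℝ) (κ : S → U → ℝ) (V : S → U → Y → ℝ) (u : U) (y : Y) : ℝ :=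
  ∑ s, p s * κ s u * V s u y

/-- Law of the output. -/
def outputLaw [Fintype U] (p : S → ℝ) (κ : S → U → ℝ) (V : S → U → Y → ℝ) (y : Y) : ℝ :=
  ∑ s, ∑ u, p s * κ s u * V s u y

/-- Probability that the codeword `u` is acceptable for the state `s`. -/
def acceptProb (p : S → ℝ) (κ : S → U → ℝ) (M : ℝ) (s : S) (u : U) : ℝ :=
  if κ s u ≤ M * inputLaw p κ u then κ s u / (M * inputLaw p κ u) else 0

/-- Conditional probability that the codeword is typical with the state `s`. -/
def typicalMass [Fintype U] (p : S → ℝ) (κ : S → U → ℝ) (M : ℝ) (s : S) : ℝ :=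
  ∑ u, if κ s u ≤ M * inputLaw p κ u then κ s u else 0

/-- Channel from the state to the output when the codeword with index `τ s` is sent, and a fresh
codeword of law `κ s` when the encoder fails. -/
def codeKernel [Fintype U] (κ : S → U → ℝ) (V : S → U → Y → ℝ) {N : ℕ} (c : Fin N → U)
    (τ : S → Option (Fin N)) (s : S) (y : Y) : ℝ :=
  (τ s).elim (∑ u, κ s u * V s u y) fun t => V s (c t) y

/-- Output law induced by a code. -/
def codeOutput [Fintype U] (p : S → ℝ) (κ : S → U → ℝ) (V : S → U → Y → ℝ) {N : ℕ} (c : Fin N → U)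
    (τ : S → Option (Fin N)) (y : Y) : ℝ :=
  ∑ s, p s * codeKernel κ V c τ s y

/-- Bound for the mean of the induced output law given the transmitted triple. -/
def outputBound [Fintype U] (p : S → ℝ) (κ : S → U → ℝ) (V : S → U → Y → ℝ) (M : ℝ) (N : ℕ)
    (s : S) (u : U) (y : Y) : ℝ :=
  p s * V s u y + (2 * N / M + 1) * outputLaw p κ V y +
    inputOutputLaw p κ V u y / (M * inputLaw p κ u)

theorem option_elim_eq_sum {N : ℕ} (o : Option (Fin N)) (b : ℝ) (F : Fin N → ℝ) :
    o.elim b F = ∑ t, (if o = some t then (1 : ℝ) else 0) * F t +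
      (if o = none then (1 : ℝ) else 0) * b := by
  cases o <;> simp

/-- First-moment method. The positive weight is kept because it forces accepted codewords to satisfy
`0 < κ s u`, which the logarithms of densities need. -/
theorem exists_weight_pos_le {C : Type*} [Fintype C] (w X : C → ℝ) (hw : ∀ c, 0 ≤ w c)
    (hw1 : ∑ c, w c = 1) {K : ℝ} (h : ∑ c, w c * X c ≤ K) : ∃ c, 0 < w c ∧ X c ≤ K := by
  by_contra! hne
  have hle : ∀ c, w c * K ≤ w c * X c := fun c => by
    rcases (hw c).eq_or_lt with h0 | h0
    · simp [← h0]
    · exact mul_le_mul_of_nonneg_left (hne c h0).le h0.le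
  obtain ⟨c, -, hc⟩ : ∃ c ∈ Finset.univ, 0 < w c := by
    by_contra! h0
    have := Finset.sum_nonpos h0
    linarith
  have := Finset.sum_lt_sum (fun c (_ : c ∈ Finset.univ) => hle c)
    ⟨c, Finset.mem_univ c, mul_lt_mul_of_pos_left (hne c hc) hc⟩
  rw [← Finset.sum_mul, hw1] at this
  linarith

/-- The power is at most exp(-aN/M), and convexity of exp puts this below the chord between the
exponents 0 and -N/M. With a the typical mass, failure is an atypical part plus an exponentially
small one. -/
theorem one_sub_pow_le {a M : ℝ} (ha0 : 0 ≤ a) (ha1 : a ≤ 1) (hM : 2 ≤ M) (N : ℕ) :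
    (1 - a / M) ^ N ≤ (1 - a) + Real.exp (-(N / M)) := by
  have hM0 : 0 < M := by linarith
  have h0 : 0 ≤ 1 - a / M := by
    rw [sub_nonneg, div_le_one hM0]; linarith
  have h1 : (1 - a / M) ^ N ≤ Real.exp (a * (-(N / M))) := by
    calc _ ≤ Real.exp (-(a / M)) ^ N :=
          pow_le_pow_left₀ h0 (by linarith [Real.add_one_le_exp (-(a / M))]) N
      _ = _ := by rw [← Real.exp_nat_mul]; congr 1; ring
  have h2 := convexOn_exp.2 (Set.mem_univ (0 : ℝ)) (Set.mem_univ (-(N / M : ℝ)))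
    (sub_nonneg.2 ha1) ha0 (by ring)
  simp only [smul_eq_mul, mul_zero, zero_add, Real.exp_zero, mul_one] at h2
  have h3 := mul_le_mul_of_nonneg_right ha1 (Real.exp_pos (-(N / M : ℝ))).le
  linarith

/-- With G the geometric sum, (G/M)a = 1 - (1 - a/M)^N. If G/M ≤ 1, the success term (G/M)e is at
most e ≤ E. Otherwise its excess over e is at most (G/M - 1)aB ≤ (1 - a)B. -/
theorem geom_average_le {a M e E B : ℝ} (ha1 : a ≤ 1) (hM : 2 ≤ M) (hB : 0 ≤ B)
    (he0 : 0 ≤ e) (he : e ≤ a * B) (heE : e ≤ E) (N : ℕ) :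
    ∑ t : Fin N, (1 - a / M) ^ (t : ℕ) * (e / M) + (1 - a / M) ^ N * B ≤
      E + ((1 - a) + (1 - a / M) ^ N) * B := by
  have hM0 : 0 < M := by linarith
  have h0 : 0 ≤ 1 - a / M := by
    rw [sub_nonneg, div_le_one hM0]; linarith
  have hgeo := geom_sum_mul_neg (1 - a / M) N
  rw [← Finset.sum_mul, Fin.sum_univ_eq_sum_range (fun t => (1 - a / M) ^ t)]
  set G := ∑ i ∈ Finset.range N, (1 - a / M) ^ i
  have hG : 0 ≤ G := Finset.sum_nonneg fun i _ => pow_nonneg h0 i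
  have hga : G / M * a = 1 - (1 - a / M) ^ N := by rw [← hgeo]; ring
  have hr : G * (e / M) = G / M * e := by ring
  have hg : 0 ≤ G / M := by positivity
  rw [hr]
  rcases le_total (G / M) 1 with h | h
  · have := mul_le_mul_of_nonneg_right h he0
    have := mul_nonneg (sub_nonneg.2 ha1) hB
    linarith
  · have h1 := mul_le_mul_of_nonneg_left he (sub_nonneg.2 h)
    have h2 : (G / M - 1) * (a * B) = (G / M * a) * B - a * B := by ring
    rw [h2, hga] at h1
    have := mul_nonneg (pow_nonneg h0 N) hB
    linarith

variable (p : S → ℝ) (κ : S → U → ℝ) (M : ℝ)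

theorem inputLaw_nonneg (hp : ∀ s, 0 ≤ p s) (hκ : ∀ s u, 0 ≤ κ s u) (u : U) :
    0 ≤ inputLaw p κ u :=
  Finset.sum_nonneg fun s _ => mul_nonneg (hp s) (hκ s u)

theorem sum_inputLaw [Fintype U] (hp1 : ∑ s, p s = 1) (hκ1 : ∀ s, ∑ u, κ s u = 1) :
    ∑ u, inputLaw p κ u = 1 := by
  simp only [inputLaw]
  rw [Finset.sum_comm]
  simp [← Finset.mul_sum, hκ1, hp1]

variable {p κ M}

theorem acceptProb_nonneg (hp : ∀ s, 0 ≤ p s) (hκ : ∀ s u, 0 ≤ κ s u) (hM : 0 < M)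
    (s : S) (u : U) : 0 ≤ acceptProb p κ M s u := by
  unfold acceptProb
  split_ifs
  · exact div_nonneg (hκ s u) (mul_nonneg hM.le (inputLaw_nonneg p κ hp hκ u))
  · rfl

theorem acceptProb_le_div (hp : ∀ s, 0 ≤ p s) (hκ : ∀ s u, 0 ≤ κ s u) (hM : 0 < M)
    (s : S) (u : U) : acceptProb p κ M s u ≤ κ s u / (M * inputLaw p κ u) := by
  unfold acceptProb
  split_ifs
  · rfl
  · exact div_nonneg (hκ s u) (mul_nonneg hM.le (inputLaw_nonneg p κ hp hκ u))

theorem acceptProb_le_one (hp : ∀ s, 0 ≤ p s) (hκ : ∀ s u, 0 ≤ κ s u) (hM : 0 < M)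
    (s : S) (u : U) : acceptProb p κ M s u ≤ 1 := by
  unfold acceptProb
  split_ifs with h
  · exact div_le_one_of_le₀ h (mul_nonneg hM.le (inputLaw_nonneg p κ hp hκ u))
  · exact zero_le_one

theorem pos_of_acceptProb_pos (hκ : ∀ s u, 0 ≤ κ s u) {s : S} {u : U}
    (h : 0 < acceptProb p κ M s u) : 0 < κ s u := by
  refine lt_of_le_of_ne (hκ s u) fun h0 => h.ne' ?_
  simp [acceptProb, ← h0]

/-- The rejection sampling identity: drawing from `inputLaw` and then accepting reproduces the
truncated conditional law, scaled by 1/M. The truncation keeps the acceptance probability at most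
one. -/
theorem inputLaw_mul_acceptProb (hκ : ∀ s u, 0 ≤ κ s u) (hM : 0 < M) (s : S) (u : U) :
    inputLaw p κ u * acceptProb p κ M s u =
      (if κ s u ≤ M * inputLaw p κ u then κ s u else 0) / M := by
  unfold acceptProb
  split_ifs with h
  · by_cases h0 : inputLaw p κ u = 0
    · have : κ s u = 0 := le_antisymm (by simpa [h0] using h) (hκ s u)
      simp [h0, this]
    · field_simp
  · simp

theorem inputLaw_mul_acceptProb_le (hκ : ∀ s u, 0 ≤ κ s u) (hM : 0 < M) (s : S) (u : U) :
    inputLaw p κ u * acceptProb p κ M s u ≤ κ s u / M := by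
  rw [inputLaw_mul_acceptProb hκ hM]
  gcongr
  split_ifs
  · rfl
  · exact hκ s u

/-- Union bound: replacing the first accepting entry by all accepting entries removes the dependence
between entries, and failed states contribute at most `outputLaw`. -/
theorem codeOutput_le [Fintype U] {V : S → U → Y → ℝ} (hp : ∀ s, 0 ≤ p s) (hκ : ∀ s u, 0 ≤ κ s u) (hV : ∀ s u y, 0 ≤ V s u y)
    {N : ℕ} (c : Fin N → U × (S → Bool)) (y : Y) :
    codeOutput p κ V (fun i => (c i).1) (fun s => Fin.find? fun i => (c i).2 s) y ≤
      outputLaw p κ V y + ∑ i, ∑ s, (if (c i).2 s then 1 else 0) * (p s * V s (c i).1 y) := by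
  rw [Finset.sum_comm, codeOutput, outputLaw, ← Finset.sum_add_distrib]
  refine Finset.sum_le_sum fun s _ => ?_
  have h1 : 0 ≤ ∑ u, p s * κ s u * V s u y := Finset.sum_nonneg fun u _ =>
    mul_nonneg (mul_nonneg (hp s) (hκ s u)) (hV s u y)
  have h2 : ∀ i, 0 ≤ (if (c i).2 s then 1 else 0) * (p s * V s (c i).1 y) := fun i => by
    have := mul_nonneg (hp s) (hV s (c i).1 y)
    split_ifs <;> simp [this]
  simp only [codeKernel]
  rcases h : Fin.find? fun i => (c i).2 s with _ | t
  · simp only [Option.elim_none, Finset.mul_sum, ← mul_assoc]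
    have := Finset.sum_nonneg fun i (_ : i ∈ Finset.univ) => h2 i
    simp only [← mul_assoc] at this
    linarith
  · rw [Fin.find?_eq_some_iff] at h
    have := Finset.single_le_sum (fun i _ => h2 i) (Finset.mem_univ t)
    simp only [h.1, if_true, one_mul] at this
    simp only [Option.elim_some]
    linarith

variable [Fintype U]

theorem typicalMass_nonneg (hκ : ∀ s u, 0 ≤ κ s u) (s : S) : 0 ≤ typicalMass p κ M s :=
  Finset.sum_nonneg fun u _ => by
    split_ifs
    · exact hκ s u
    · rfl

theorem typicalMass_le_one (hκ : ∀ s u, 0 ≤ κ s u) (hκ1 : ∀ s, ∑ u, κ s u = 1) (s : S) :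
    typicalMass p κ M s ≤ 1 := by
  rw [← hκ1 s]
  refine Finset.sum_le_sum fun u _ => ?_
  split_ifs
  · rfl
  · exact hκ s u

variable [DecidableEq S]

theorem sum_entryWeight_one (hp1 : ∑ s, p s = 1) (hκ1 : ∀ s, ∑ u, κ s u = 1) (α : S → U → ℝ) :
    ∑ x, entryWeight (inputLaw p κ) α x = 1 := by
  have := sum_entryWeight (inputLaw p κ) α (fun _ => 1)
  simpa [sum_inputLaw p κ hp1 hκ1] using this

theorem sum_entryWeight_reject (hp1 : ∑ s, p s = 1) (hκ : ∀ s u, 0 ≤ κ s u)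
    (hκ1 : ∀ s, ∑ u, κ s u = 1) (hM : 0 < M) (s : S) :
    ∑ x : U × (S → Bool), entryWeight (inputLaw p κ) (acceptProb p κ M) x *
      (if x.2 s then 0 else 1) = 1 - typicalMass p κ M s / M := by
  have h := sum_entryWeight_accept (inputLaw p κ) (acceptProb p κ M) s (fun _ => 1)
  have h1 := sum_entryWeight_one hp1 hκ1 (acceptProb p κ M)
  simp only [mul_one, inputLaw_mul_acceptProb hκ hM, ← Finset.sum_div] at h
  rw [typicalMass, ← h, eq_sub_iff_add_eq, ← Finset.sum_add_distrib]
  refine Eq.trans (Finset.sum_congr rfl fun x _ => ?_) h1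
  split_ifs <;> simp

/-- The law of the transmitted pair, averaged over codebooks, is close to the target law. -/
theorem codebook_average_le (hp1 : ∑ s, p s = 1) (hκ : ∀ s u, 0 ≤ κ s u)
    (hκ1 : ∀ s, ∑ u, κ s u = 1) (hM : 2 ≤ M) (N : ℕ) (s : S) (φ : U → ℝ) {B : ℝ}
    (hφ0 : ∀ u, 0 ≤ φ u) (hφ : ∀ u, φ u ≤ B) (hB : 0 ≤ B) :
    ∑ c : Fin N → U × (S → Bool), (∏ i, entryWeight (inputLaw p κ) (acceptProb p κ M) (c i)) *
      (Fin.find? fun i => (c i).2 s).elim B (fun t => φ (c t).1) ≤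
    ∑ u, κ s u * φ u + (2 * (1 - typicalMass p κ M s) + Real.exp (-(N / M))) * B := by
  have hM0 : 0 < M := by linarith
  have h1 := sum_entryWeight_one hp1 hκ1 (acceptProb p κ M)
  simp_rw [option_elim_eq_sum, mul_add, Finset.mul_sum, Finset.sum_add_distrib]
  rw [Finset.sum_comm]
  simp_rw [sum_find_eq_some _ h1 (fun x => x.2 s) (fun x => φ x.1), ← mul_assoc, ← Finset.sum_mul]
  rw [sum_find_eq_none _ (fun x : U × (S → Bool) => x.2 s), sum_entryWeight_reject hp1 hκ hκ1 hM0]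
  simp_rw [mul_assoc (entryWeight _ _ _)]
  rw [sum_entryWeight_accept]
  have e : ∑ u, inputLaw p κ u * (acceptProb p κ M s u * φ u) =
      (∑ u, (if κ s u ≤ M * inputLaw p κ u then κ s u else 0) * φ u) / M := by
    rw [Finset.sum_div]
    refine Finset.sum_congr rfl fun u _ => ?_
    rw [← mul_assoc, inputLaw_mul_acceptProb hκ hM0]; ring
  have hi : ∀ u, 0 ≤ (if κ s u ≤ M * inputLaw p κ u then κ s u else 0) := fun u => by
    split_ifs
    · exact hκ s u
    · rfl
  rw [e, Finset.sum_mul]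
  refine (geom_average_le (typicalMass_le_one hκ hκ1 s) hM hB
    (Finset.sum_nonneg fun u _ => mul_nonneg (hi u) (hφ0 u)) ?_
    (E := ∑ u, κ s u * φ u) ?_ N).trans ?_
  · rw [typicalMass, Finset.sum_mul]
    exact Finset.sum_le_sum fun u _ => mul_le_mul_of_nonneg_left (hφ u) (hi u)
  · refine Finset.sum_le_sum fun u _ => mul_le_mul_of_nonneg_right ?_ (hφ0 u)
    split_ifs
    · rfl
    · exact hκ s u
  · have := one_sub_pow_le (typicalMass_nonneg (p := p) (M := M) hκ s)
      (typicalMass_le_one hκ hκ1 s) hM N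
    exact add_le_add le_rfl (mul_le_mul_of_nonneg_right (by linarith) hB)

variable [Fintype Y] {V : S → U → Y → ℝ}

/-- On average over codebooks, the induced output law is dominated by `outputBound`. -/
theorem codebook_output_ratio_le (hp : ∀ s, 0 ≤ p s) (hp1 : ∑ s, p s = 1)
    (hκ : ∀ s u, 0 ≤ κ s u) (hκ1 : ∀ s, ∑ u, κ s u = 1) (hV : ∀ s u y, 0 ≤ V s u y)
    (hV1 : ∀ s u, ∑ y, V s u y = 1) (hM : 2 ≤ M) (N : ℕ) (s : S) :
    ∑ c : Fin N → U × (S → Bool), (∏ i, entryWeight (inputLaw p κ) (acceptProb p κ M) (c i)) *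
      (Fin.find? fun i => (c i).2 s).elim 0 (fun t => ∑ y, V s (c t).1 y /
        outputBound p κ V M N s (c t).1 y *
        codeOutput p κ V (fun i => (c i).1) (fun s => Fin.find? fun i => (c i).2 s) y) ≤ 1 := by
  have hM0 : 0 < M := by linarith
  have hα0 := acceptProb_nonneg hp hκ hM0
  have hα1 := acceptProb_le_one hp hκ hM0
  have hU0 := inputLaw_nonneg p κ hp hκ
  have hB0 : ∀ y, 0 ≤ outputLaw p κ V y := fun y => Finset.sum_nonneg fun s _ =>
    Finset.sum_nonneg fun u _ => mul_nonneg (mul_nonneg (hp s) (hκ s u)) (hV s u y)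
  have hUB0 : ∀ u y, 0 ≤ inputOutputLaw p κ V u y := fun u y => Finset.sum_nonneg fun s _ =>
    mul_nonneg (mul_nonneg (hp s) (hκ s u)) (hV s u y)
  have hD0 : ∀ u y, 0 ≤ outputBound p κ V M N s u y := fun u y => by
    unfold outputBound
    have := hp s; have := hV s u y; have := hB0 y; have := hUB0 u y; have := hU0 u
    positivity
  set m := entryWeight (inputLaw p κ) (acceptProb p κ M) with hmdef
  have hm0 : ∀ x, 0 ≤ m x := entryWeight_nonneg _ _ hU0 hα0 hα1
  have hm1 : ∑ x, m x = 1 := sum_entryWeight_one hp1 hκ1 _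
  set r := 1 - typicalMass p κ M s / M with hr
  have hrej : ∑ x : U × (S → Bool), m x * (if x.2 s then 0 else 1) = r :=
    sum_entryWeight_reject hp1 hκ hκ1 hM0 s
  have hr12 : 1 / 2 ≤ r := by
    have h1 := typicalMass_le_one (p := p) (M := M) hκ hκ1 s
    have : typicalMass p κ M s / M ≤ 1 / 2 := by
      rw [div_le_div_iff₀ hM0 (by norm_num)]; linarith
    linarith
  -- The weight g normalises by the target bound; b collects what one entry contributes to the
  -- output law through all states it accepts.
  let g : Y → U → ℝ := fun y u => V s u y / outputBound p κ V M N s u y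
  let b : Y → U × (S → Bool) → ℝ := fun y x =>
    ∑ s', (if x.2 s' then 1 else 0) * (p s' * V s' x.1 y)
  have hg0 : ∀ y u, 0 ≤ g y u := fun y u => div_nonneg (hV s u y) (hD0 u y)
  have hb0 : ∀ y x, 0 ≤ b y x := fun y x => Finset.sum_nonneg fun s' _ => by
    have := mul_nonneg (hp s') (hV s' x.1 y)
    split_ifs <;> simp [this]
  -- Where the bound vanishes the quotient is zero by convention, so only an inequality holds.
  have hgD : ∀ y u, g y u * outputBound p κ V M N s u y ≤ V s u y := fun y u => by
    by_cases h : outputBound p κ V M N s u y = 0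
    · simp [h, hV]
    · exact (div_mul_cancel₀ _ h).le
  have hβ : ∀ y, ∑ x, m x * b y x ≤ outputLaw p κ V y / M := by
    intro y
    simp only [b, Finset.mul_sum]
    rw [Finset.sum_comm, outputLaw, Finset.sum_div]
    refine Finset.sum_le_sum fun s' _ => ?_
    rw [hmdef, sum_entryWeight_accept (inputLaw p κ) (acceptProb p κ M) s'
      (fun u => p s' * V s' u y), Finset.sum_div]
    refine Finset.sum_le_sum fun u _ => ?_
    have := mul_le_mul_of_nonneg_right (inputLaw_mul_acceptProb_le (p := p) hκ hM0 s' u)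
      (mul_nonneg (hp s') (hV s' u y))
    calc _ = _ := (mul_assoc _ _ _).symm
      _ ≤ _ := this
      _ = _ := by ring
  -- The entry sent also serves other states. The state s itself contributes p(s)V; every other
  -- state is accepted independently, and these acceptances sum to the last term of `outputBound`.
  have he' : ∀ y, ∑ x : U × (S → Bool), m x * ((if x.2 s then 1 else 0) * (g y x.1 * b y x)) ≤
      ∑ u, inputLaw p κ u * (acceptProb p κ M s u * (g y u * (p s * V s u y +
        inputOutputLaw p κ V u y / (M * inputLaw p κ u)))) := by
    intro y
    have e1 : ∀ s', ∑ x : U × (S → Bool), m x * ((if x.2 s then 1 else 0) *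
        (g y x.1 * ((if x.2 s' then 1 else 0) * (p s' * V s' x.1 y)))) ≤
        ∑ u, inputLaw p κ u * (acceptProb p κ M s u * (g y u * ((if s' = s then p s * V s u y
          else 0) + acceptProb p κ M s' u * (p s' * V s' u y)))) := by
      intro s'
      by_cases h : s' = s
      · subst h
        have := sum_entryWeight_accept (inputLaw p κ) (acceptProb p κ M) s'
          (fun u => g y u * (p s' * V s' u y))
        rw [← hmdef] at this
        calc _ = ∑ x : U × (S → Bool), m x * ((if x.2 s' then 1 else 0) *
              (g y x.1 * (p s' * V s' x.1 y))) := by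
              refine Finset.sum_congr rfl fun x _ => ?_
              split_ifs <;> simp
          _ = _ := this
          -- A nonnegative term for s' = s is added, so that the sum of acceptance probabilities
          -- runs over all states.
          _ ≤ _ := by
              refine Finset.sum_le_sum fun u _ => ?_
              have h1 := hU0 u; have h2 := hα0 s' u; have h3 := hg0 y u
              have h4 := hp s'; have h5 := hV s' u y
              simp only [if_true]
              gcongr
              have : 0 ≤ acceptProb p κ M s' u * (p s' * V s' u y) := by positivity
              linarith
      · have := sum_entryWeight_accept_accept (inputLaw p κ) (acceptProb p κ M) s s' h
          (fun u => g y u * (p s' * V s' u y))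
        rw [← hmdef] at this
        apply le_of_eq
        calc _ = ∑ x : U × (S → Bool), m x * ((if x.2 s then 1 else 0) *
              (if x.2 s' then 1 else 0) * (g y x.1 * (p s' * V s' x.1 y))) := by
              refine Finset.sum_congr rfl fun x _ => ?_
              ring
          _ = _ := this
          _ = _ := by
              refine Finset.sum_congr rfl fun u _ => ?_
              simp only [h, if_false]; ring
    calc _ = ∑ s', ∑ x : U × (S → Bool), m x * ((if x.2 s then 1 else 0) *
        (g y x.1 * ((if x.2 s' then 1 else 0) * (p s' * V s' x.1 y)))) := by
          rw [Finset.sum_comm]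
          refine Finset.sum_congr rfl fun x _ => ?_
          simp only [b, Finset.mul_sum]
      _ ≤ _ := Finset.sum_le_sum fun s' _ => e1 s'
      _ = ∑ u, inputLaw p κ u * (acceptProb p κ M s u * (g y u * (p s * V s u y +
            ∑ s', acceptProb p κ M s' u * (p s' * V s' u y)))) := by
          rw [Finset.sum_comm]
          refine Finset.sum_congr rfl fun u _ => ?_
          simp only [← Finset.mul_sum, Finset.sum_add_distrib]
          simp
      _ ≤ _ := by
          refine Finset.sum_le_sum fun u _ => ?_
          have h1 := hU0 u; have h2 := hα0 s u; have h3 := hg0 y u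
          gcongr
          rw [inputOutputLaw, Finset.sum_div]
          refine Finset.sum_le_sum fun s' _ => ?_
          have := mul_le_mul_of_nonneg_right (acceptProb_le_div hp hκ hM0 s' u)
            (mul_nonneg (hp s') (hV s' u y))
          refine this.trans (le_of_eq ?_)
          ring
  have hterm : ∀ (t : Fin N) (y : Y), ∑ c : Fin N → U × (S → Bool), (∏ i, m (c i)) *
      ((if Fin.find? (fun i => (c i).2 s) = some t then (1 : ℝ) else 0) * (g y (c t).1 *
        codeOutput p κ V (fun i => (c i).1) (fun s => Fin.find? fun i => (c i).2 s) y)) ≤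
      r ^ (t : ℕ) * ∑ u, inputLaw p κ u * (acceptProb p κ M s u * V s u y) := by
    intro t y
    let I : (Fin N → U × (S → Bool)) → ℝ := fun c =>
      if Fin.find? (fun i => (c i).2 s) = some t then (1 : ℝ) else 0
    have hI : ∀ c, 0 ≤ I c := fun c => by simp only [I]; split_ifs <;> norm_num
    have hW : ∀ c : Fin N → U × (S → Bool), 0 ≤ ∏ i, m (c i) :=
      fun c => Finset.prod_nonneg fun i _ => hm0 _
    set e := ∑ x : U × (S → Bool), m x * ((if x.2 s then 1 else 0) * g y x.1) with he
    have hWe : ∑ c : Fin N → U × (S → Bool), (∏ i, m (c i)) * (I c * g y (c t).1) =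
        r ^ (t : ℕ) * e := by
      have := sum_find_eq_some m hm1 (fun x => x.2 s) (fun x => g y x.1) t
      rw [hrej] at this
      exact this
    have hWb : ∑ c : Fin N → U × (S → Bool), (∏ i, m (c i)) * (I c * (g y (c t).1 * b y (c t))) =
        r ^ (t : ℕ) * ∑ x : U × (S → Bool), m x * ((if x.2 s then 1 else 0) *
          (g y x.1 * b y x)) := by
      have := sum_find_eq_some m hm1 (fun x => x.2 s) (fun x => g y x.1 * b y x) t
      rw [hrej] at this
      exact this
    have hcross : ∀ t', t' ≠ t → ∑ c : Fin N → U × (S → Bool), (∏ i, m (c i)) *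
        (I c * g y (c t).1 * b y (c t')) ≤ 2 * (outputLaw p κ V y / M) * (r ^ (t : ℕ) * e) := by
      intro t' htt
      have := sum_find_eq_some_mul_le m hm0 hm1 (fun x => x.2 s) (by rw [hrej]; exact hr12)
        (fun x => g y x.1) (b y) (fun x => hg0 _ _) (hb0 y) t t' htt
      refine this.trans ?_
      rw [← hWe]
      refine mul_le_mul_of_nonneg_right (by linarith [hβ y]) (Finset.sum_nonneg fun c _ =>
        mul_nonneg (hW c) (mul_nonneg (hI c) (hg0 _ _)))
    have hrt : 0 ≤ r ^ (t : ℕ) := pow_nonneg (by linarith) _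
    have he_eq : e = ∑ u, inputLaw p κ u * (acceptProb p κ M s u * g y u) :=
      sum_entryWeight_accept _ _ _ _
    have he0 : 0 ≤ e := by
      rw [he_eq]
      exact Finset.sum_nonneg fun u _ => mul_nonneg (hU0 u) (mul_nonneg (hα0 s u) (hg0 y u))
    -- Failed states, the entry t, and the other entries are separated; they produce the terms of
    -- `outputBound`.
    calc _ ≤ ∑ c : Fin N → U × (S → Bool), (∏ i, m (c i)) * (I c * (g y (c t).1 *
          (outputLaw p κ V y + ∑ i, b y (c i)))) := by
          refine Finset.sum_le_sum fun c _ => mul_le_mul_of_nonneg_left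
            (mul_le_mul_of_nonneg_left (mul_le_mul_of_nonneg_left
              (codeOutput_le hp hκ hV c y) (hg0 _ _)) (hI c)) (hW c)
      _ = outputLaw p κ V y * (r ^ (t : ℕ) * e) +
          ∑ c : Fin N → U × (S → Bool), (∏ i, m (c i)) * (I c * (g y (c t).1 * b y (c t))) +
          ∑ t' ∈ Finset.univ.erase t, ∑ c : Fin N → U × (S → Bool), (∏ i, m (c i)) *
            (I c * g y (c t).1 * b y (c t')) := by
          rw [← hWe, Finset.sum_comm, Finset.mul_sum, ← Finset.sum_add_distrib,
            ← Finset.sum_add_distrib]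
          refine Finset.sum_congr rfl fun c _ => ?_
          rw [← Finset.add_sum_erase _ _ (Finset.mem_univ t), ← Finset.mul_sum, ← Finset.mul_sum]
          ring
      _ ≤ outputLaw p κ V y * (r ^ (t : ℕ) * e) +
          r ^ (t : ℕ) * ∑ u, inputLaw p κ u * (acceptProb p κ M s u * (g y u * (p s * V s u y +
            inputOutputLaw p κ V u y / (M * inputLaw p κ u)))) +
          N * (2 * (outputLaw p κ V y / M) * (r ^ (t : ℕ) * e)) := by
          refine add_le_add (add_le_add le_rfl ?_) ?_
          · rw [hWb]; exact mul_le_mul_of_nonneg_left (he' y) hrt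
          · have h1 := Finset.sum_le_card_nsmul (Finset.univ.erase t) _ _
              fun t' ht' => hcross t' (Finset.ne_of_mem_erase ht')
            refine h1.trans ?_
            rw [nsmul_eq_mul]
            have h2 := hB0 y
            have h3 : ((Finset.univ.erase t).card : ℝ) ≤ N := by
              have := Finset.card_erase_le (s := Finset.univ) (a := t)
              simp only [Finset.card_univ, Fintype.card_fin] at this
              exact_mod_cast this
            gcongr
      _ = r ^ (t : ℕ) * ∑ u, inputLaw p κ u * (acceptProb p κ M s u *
            (g y u * outputBound p κ V M N s u y)) := by
          rw [he_eq]
          simp only [Finset.mul_sum, ← Finset.sum_add_distrib]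
          refine Finset.sum_congr rfl fun u _ => ?_
          unfold outputBound
          ring
      _ ≤ _ := by
          refine mul_le_mul_of_nonneg_left (Finset.sum_le_sum fun u _ => ?_) hrt
          exact mul_le_mul_of_nonneg_left (mul_le_mul_of_nonneg_left (hgD y u) (hα0 s u)) (hU0 u)
  calc _ = ∑ t : Fin N, ∑ y, ∑ c : Fin N → U × (S → Bool), (∏ i, m (c i)) *
      ((if Fin.find? (fun i => (c i).2 s) = some t then (1 : ℝ) else 0) * (g y (c t).1 *
        codeOutput p κ V (fun i => (c i).1) (fun s => Fin.find? fun i => (c i).2 s) y)) := by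
        simp_rw [option_elim_eq_sum, mul_zero, add_zero, Finset.mul_sum]
        rw [Finset.sum_comm]
        exact Finset.sum_congr rfl fun t _ => Finset.sum_comm
    _ ≤ ∑ t : Fin N, ∑ y, r ^ (t : ℕ) *
        ∑ u, inputLaw p κ u * (acceptProb p κ M s u * V s u y) :=
        Finset.sum_le_sum fun t _ => Finset.sum_le_sum fun y _ => hterm t y
    -- Summing V over y leaves the acceptance probability 1 - r, so the total is the probability of
    -- success.
    _ = (∑ t : Fin N, r ^ (t : ℕ)) * (1 - r) := by
        rw [Finset.sum_mul]
        refine Finset.sum_congr rfl fun t _ => ?_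
        rw [← Finset.mul_sum, Finset.sum_comm]
        simp only [← Finset.mul_sum, hV1, mul_one, inputLaw_mul_acceptProb hκ hM0,
          ← Finset.sum_div]
        rw [hr, typicalMass]; ring
    _ ≤ 1 := by
        rw [Fin.sum_univ_eq_sum_range (fun t => r ^ t), geom_sum_mul_neg]
        linarith [pow_nonneg (by linarith : 0 ≤ r) N]

/-- Random coding: a code for which the mean of `φ` under the induced law is close to its mean under
the target law, and whose output law is dominated by `outputBound`. -/
theorem exists_code (hp : ∀ s, 0 ≤ p s) (hp1 : ∑ s, p s = 1)
    (hκ : ∀ s u, 0 ≤ κ s u) (hκ1 : ∀ s, ∑ u, κ s u = 1) (hV : ∀ s u y, 0 ≤ V s u y)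
    (hV1 : ∀ s u, ∑ y, V s u y = 1) (hM : 2 ≤ M) (N : ℕ) (φ : S → U → ℝ) {B : ℝ}
    (hφ0 : ∀ s u, 0 ≤ φ s u) (hφ : ∀ s u, φ s u ≤ B) (hB : 0 ≤ B) :
    ∃ (c : Fin N → U) (τ : S → Option (Fin N)), (∀ s t, τ s = some t → 0 < κ s (c t)) ∧
      ∑ s, p s * (τ s).elim B (fun t => φ s (c t) + ∑ y, V s (c t) y /
        outputBound p κ V M N s (c t) y * codeOutput p κ V c τ y) ≤
      ∑ s, ∑ u, p s * κ s u * φ s u +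
        (2 * (1 - ∑ s, p s * typicalMass p κ M s) + Real.exp (-(N / M))) * B + 1 := by
  have hM0 : 0 < M := by linarith
  have hα0 := acceptProb_nonneg hp hκ hM0
  have hα1 := acceptProb_le_one hp hκ hM0
  have hU0 := inputLaw_nonneg p κ hp hκ
  set m := entryWeight (inputLaw p κ) (acceptProb p κ M) with hmdef
  have hm0 : ∀ x, 0 ≤ m x := entryWeight_nonneg _ _ hU0 hα0 hα1
  have hm1 : ∑ x, m x = 1 := sum_entryWeight_one hp1 hκ1 _
  -- Fluctuations, failures and the output ratio share one expectation, so one codebook controls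
  -- them all.
  obtain ⟨c, hc, hX⟩ := exists_weight_pos_le (fun c : Fin N → U × (S → Bool) => ∏ i, m (c i))
    (fun c => ∑ s, p s * (Fin.find? fun i => (c i).2 s).elim B (fun t => φ s (c t).1 +
      ∑ y, V s (c t).1 y / outputBound p κ V M N s (c t).1 y *
        codeOutput p κ V (fun i => (c i).1) (fun s => Fin.find? fun i => (c i).2 s) y))
    (fun c => Finset.prod_nonneg fun i _ => hm0 _)
    (by rw [sum_tuple_prod (fun _ => m)]; simp [hm1])
    (K := ∑ s, ∑ u, p s * κ s u * φ s u +
        (2 * (1 - ∑ s, p s * typicalMass p κ M s) + Real.exp (-(N / M))) * B + 1) (by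
      have hsplit : ∀ (o : Option (Fin N)) (F G : Fin N → ℝ),
          o.elim B (fun t => F t + G t) = o.elim B F + o.elim 0 G := by
        intro o F G; cases o <;> simp
      simp_rw [hsplit, Finset.mul_sum]
      rw [Finset.sum_comm]
      calc _ ≤ ∑ s, p s * ((∑ u, κ s u * φ s u +
            (2 * (1 - typicalMass p κ M s) + Real.exp (-(N / M))) * B) + 1) := by
            refine Finset.sum_le_sum fun s _ => ?_
            have h1 := codebook_average_le hp1 hκ hκ1 hM N s (φ s) (hφ0 s) (hφ s) hB
            have h2 := codebook_output_ratio_le hp hp1 hκ hκ1 hV hV1 hM N s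
            have h3 := mul_le_mul_of_nonneg_left (add_le_add h1 h2) (hp s)
            refine le_trans (le_of_eq ?_) h3
            rw [← Finset.sum_add_distrib, Finset.mul_sum]
            refine Finset.sum_congr rfl fun c _ => ?_
            ring
        _ = _ := by
            have e : ∀ s, p s * ((∑ u, κ s u * φ s u +
                (2 * (1 - typicalMass p κ M s) + Real.exp (-(N / M))) * B) + 1) =
                ∑ u, p s * κ s u * φ s u + (p s * (2 * B + Real.exp (-(N / M)) * B + 1) -
                  p s * typicalMass p κ M s * (2 * B)) := by
              intro s
              simp only [mul_assoc, ← Finset.mul_sum]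
              ring
            simp_rw [e, Finset.sum_add_distrib, Finset.sum_sub_distrib, ← Finset.sum_mul, hp1]
            ring)
  refine ⟨fun i => (c i).1, fun s => Fin.find? fun i => (c i).2 s, fun s t hst => ?_, hX⟩
  have hct : 0 < m (c t) := by
    refine lt_of_le_of_ne (hm0 _) fun h => hc.ne' ?_
    exact Finset.prod_eq_zero (Finset.mem_univ t) h.symm
  rw [Fin.find?_eq_some_iff] at hst
  exact pos_of_acceptProb_pos hκ (accept_pos_of_entryWeight_pos _ _ hα0 _ hct s hst.1)

end RandomCoding

/-! ### Mutual information achieved by a code -/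

section CodeInformation

variable {S U Y : Type*} [Fintype S] [Fintype Y]

/-- Information between the input of law `p` and the output of the channel `K`. -/
def channelInfo (p : S → ℝ) (K : S → Y → ℝ) : ℝ :=
  ∑ s, p s * ∑ y, K s y * (Real.logb 2 (K s y) - Real.logb 2 (∑ s', p s' * K s' y))

/-- The difference of the two sides is the divergence of the true output law from Q, so any
reference law gives an upper bound. -/
theorem channelInfo_le (p : S → ℝ) (K : S → Y → ℝ) (hp : ∀ s, 0 ≤ p s) (hp1 : ∑ s, p s = 1)
    (hK : ∀ s y, 0 ≤ K s y) (hK1 : ∀ s, ∑ y, K s y = 1) (Q : Y → ℝ) (hQ : ∀ y, 0 ≤ Q y)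
    (hQ1 : ∑ y, Q y ≤ 1) (hac : ∀ s y, 0 < p s → 0 < K s y → 0 < Q y) :
    channelInfo p K ≤ ∑ s, p s * ∑ y, K s y * (Real.logb 2 (K s y) - Real.logb 2 (Q y)) := by
  have h := gibbs_inequality (fun y => ∑ s, p s * K s y) Q
    (fun y => Finset.sum_nonneg fun s _ => mul_nonneg (hp s) (hK s y)) hQ
    (by rw [Finset.sum_comm]; simp [← Finset.mul_sum, hK1, hp1]) hQ1 (by
      intro y hy
      obtain ⟨s, -, hs⟩ := Finset.exists_lt_of_sum_lt (s := Finset.univ) (f := fun _ : S => (0 : ℝ))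
        (g := fun s => p s * K s y) (by simpa using hy)
      refine hac s y ?_ ?_
      · exact (hp s).lt_of_ne fun h => by simp [← h] at hs
      · exact (hK s y).lt_of_ne fun h => by simp [← h] at hs)
  have e : ∀ R : Y → ℝ, ∑ s, p s * ∑ y, K s y * (Real.logb 2 (K s y) - Real.logb 2 (R y)) =
      ∑ s, p s * ∑ y, K s y * Real.logb 2 (K s y) -
        ∑ y, (∑ s, p s * K s y) * Real.logb 2 (R y) := by
    intro R
    simp only [mul_sub, Finset.sum_sub_distrib, Finset.sum_mul, Finset.mul_sum]
    congr 1
    rw [Finset.sum_comm]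
    simp only [mul_assoc]
  rw [channelInfo, e, e]
  linarith

variable [Fintype U] {p : S → ℝ} {κ : S → U → ℝ} {V : S → U → Y → ℝ}

omit [Fintype S] [Fintype Y] in
theorem codeKernel_nonneg (hκ : ∀ s u, 0 ≤ κ s u) (hV : ∀ s u y, 0 ≤ V s u y) {N : ℕ}
    (c : Fin N → U) (τ : S → Option (Fin N)) (s : S) (y : Y) : 0 ≤ codeKernel κ V c τ s y := by
  unfold codeKernel
  cases τ s
  · exact Finset.sum_nonneg fun u _ => mul_nonneg (hκ s u) (hV s u y)
  · exact hV _ _ _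

omit [Fintype S] in
theorem sum_codeKernel (hκ1 : ∀ s, ∑ u, κ s u = 1) (hV1 : ∀ s u, ∑ y, V s u y = 1) {N : ℕ}
    (c : Fin N → U) (τ : S → Option (Fin N)) (s : S) : ∑ y, codeKernel κ V c τ s y = 1 := by
  unfold codeKernel
  cases τ s
  · simp only [Option.elim_none]
    rw [Finset.sum_comm]
    simp [← Finset.mul_sum, hV1, hκ1]
  · exact hV1 _ _

/-- A success costs A plus a fluctuation F whose mean is at most φ; a failed state is charged the
crude bound L. The reference law stays free in order to be chosen in two ways. -/
theorem channelInfo_code_le (hp : ∀ s, 0 ≤ p s) (hp1 : ∑ s, p s = 1) (hκ : ∀ s u, 0 ≤ κ s u)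
    (hκ1 : ∀ s, ∑ u, κ s u = 1) (hV : ∀ s u y, 0 ≤ V s u y) (hV1 : ∀ s u, ∑ y, V s u y = 1)
    {N : ℕ} (c : Fin N → U) (τ : S → Option (Fin N)) (Q : Y → ℝ) (hQ : ∀ y, 0 ≤ Q y)
    (hQ1 : ∑ y, Q y ≤ 1) (F : S → U → Y → ℝ) (φ : S → U → ℝ) {A B L : ℝ} (hL : L ≤ A + B)
    (hF : ∀ s u, ∑ y, V s u y * F s u y ≤ φ s u)
    (hsucc : ∀ s t y, 0 < p s → τ s = some t → 0 < V s (c t) y →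
      0 < Q y ∧ Real.logb 2 (V s (c t) y) - Real.logb 2 (Q y) ≤ A + F s (c t) y)
    (hfail : ∀ s y, 0 < p s → 0 < ∑ u, κ s u * V s u y →
      0 < Q y ∧ Real.logb 2 (∑ u, κ s u * V s u y) - Real.logb 2 (Q y) ≤ L) :
    channelInfo p (codeKernel κ V c τ) ≤ A + ∑ s, p s * (τ s).elim B (fun t => φ s (c t)) := by
  have hK0 := codeKernel_nonneg hκ hV c τ
  have hK1 := sum_codeKernel hκ1 hV1 c τ
  refine (channelInfo_le p _ hp hp1 hK0 hK1 Q hQ hQ1 ?_).trans ?_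
  · intro s y hs hK
    rcases h : τ s with _ | t
    · exact (hfail s y hs (by simpa [codeKernel, h] using hK)).1
    · exact (hsucc s t y hs h (by simpa [codeKernel, h] using hK)).1
  · have e : A + ∑ s, p s * (τ s).elim B (fun t => φ s (c t)) =
        ∑ s, p s * (A + (τ s).elim B (fun t => φ s (c t))) := by
      simp only [mul_add, Finset.sum_add_distrib, ← Finset.sum_mul, hp1, one_mul]
    rw [e]
    refine Finset.sum_le_sum fun s _ => ?_
    rcases (hp s).eq_or_lt with hs | hs
    · simp [← hs]
    refine mul_le_mul_of_nonneg_left ?_ hs.le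
    rcases h : τ s with _ | t
    · have hk : ∀ y, codeKernel κ V c τ s y = ∑ u, κ s u * V s u y := fun y => by
        simp [codeKernel, h]
      calc _ ≤ ∑ y, codeKernel κ V c τ s y * L := by
            refine Finset.sum_le_sum fun y _ => ?_
            rcases (hK0 s y).eq_or_lt with h0 | h0
            · simp [← h0]
            · refine mul_le_mul_of_nonneg_left ?_ h0.le
              rw [hk] at h0 ⊢
              exact (hfail s y hs h0).2
        _ = L := by rw [← Finset.sum_mul, hK1, one_mul]
        _ ≤ _ := hL
    · have hk : ∀ y, codeKernel κ V c τ s y = V s (c t) y := fun y => by simp [codeKernel, h]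
      simp only [hk, Option.elim_some]
      calc _ ≤ ∑ y, (V s (c t) y * A + V s (c t) y * F s (c t) y) := by
            refine Finset.sum_le_sum fun y _ => ?_
            rcases (hV s (c t) y).eq_or_lt with h0 | h0
            · simp [← h0]
            · rw [← mul_add]
              exact mul_le_mul_of_nonneg_left (hsucc s t y hs h h0).2 h0.le
        _ ≤ _ := by
            rw [Finset.sum_add_distrib, ← Finset.sum_mul, hV1, one_mul]
            exact add_le_add le_rfl (hF s _)

/-- Let q be the ratio of the induced output law to `outputBound`. As ln 2 > 1/2, log₂ q ≤ (q -
1)/ln 2 ≤ 2q, so replacing the induced law by `outputBound` costs 2q, whose mean `exists_code`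
controls. On failure the induced law is at most one, and the information is at least -L. -/
theorem le_channelInfo_code (hp : ∀ s, 0 ≤ p s) (hp1 : ∑ s, p s = 1) (hκ : ∀ s u, 0 ≤ κ s u)
    (hκ1 : ∀ s, ∑ u, κ s u = 1) (hV : ∀ s u y, 0 ≤ V s u y) (hV1 : ∀ s u, ∑ y, V s u y = 1)
    {M : ℝ} (hM : 0 < M)
    {N : ℕ} (c : Fin N → U) (τ : S → Option (Fin N)) (F : S → U → Y → ℝ) (φ : S → U → ℝ)
    {A B L : ℝ} (hL : A + L ≤ B) (hB : 0 ≤ B) (hφ : ∀ s u, 0 ≤ φ s u)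
    (hF : ∀ s u, ∑ y, V s u y * F s u y ≤ φ s u)
    (hsucc : ∀ s t y, 0 < p s → τ s = some t → 0 < V s (c t) y →
      Real.logb 2 (outputBound p κ V M N s (c t) y) - Real.logb 2 (V s (c t) y) ≤
        F s (c t) y - A)
    (hfail : ∀ s y, 0 < p s → 0 < ∑ u, κ s u * V s u y →
      -L ≤ Real.logb 2 (∑ u, κ s u * V s u y)) :
    A - 2 * ∑ s, p s * (τ s).elim B (fun t => φ s (c t) + ∑ y, V s (c t) y /
        outputBound p κ V M N s (c t) y * codeOutput p κ V c τ y) ≤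
      channelInfo p (codeKernel κ V c τ) := by
  have hK0 := codeKernel_nonneg hκ hV c τ
  have hK1 := sum_codeKernel hκ1 hV1 c τ
  have hpc0 : ∀ y, 0 ≤ codeOutput p κ V c τ y := fun y =>
    Finset.sum_nonneg fun s _ => mul_nonneg (hp s) (hK0 s y)
  have hpc1 : ∀ y, codeOutput p κ V c τ y ≤ 1 := by
    intro y
    have h1 : ∑ y, codeOutput p κ V c τ y = 1 := by
      simp only [codeOutput]
      rw [Finset.sum_comm]; simp [← Finset.mul_sum, hK1, hp1]
    rw [← h1]
    exact Finset.single_le_sum (fun y _ => hpc0 y) (Finset.mem_univ y)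
  have hpcpos : ∀ s y, 0 < p s → 0 < codeKernel κ V c τ s y → 0 < codeOutput p κ V c τ y :=
    fun s y hs hy => (mul_pos hs hy).trans_le
      (Finset.single_le_sum (f := fun s => p s * codeKernel κ V c τ s y)
        (fun s _ => mul_nonneg (hp s) (hK0 s y)) (Finset.mem_univ s))
  have hlog2 : 1 / 2 < Real.log 2 := by linarith [Real.log_two_gt_d9]
  have e : ∀ g : S → ℝ, A - 2 * ∑ s, p s * g s = ∑ s, p s * (A - 2 * g s) := by
    intro g
    rw [Finset.mul_sum]
    have : A = ∑ s, p s * A := by rw [← Finset.sum_mul, hp1, one_mul]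
    rw [this, ← Finset.sum_sub_distrib, ← this]
    exact Finset.sum_congr rfl fun s _ => by ring
  rw [e, channelInfo]
  refine Finset.sum_le_sum fun s _ => ?_
  rcases (hp s).eq_or_lt with hs | hs
  · simp [← hs]
  refine mul_le_mul_of_nonneg_left ?_ hs.le
  change _ ≤ ∑ y, codeKernel κ V c τ s y * (Real.logb 2 (codeKernel κ V c τ s y) -
    Real.logb 2 (codeOutput p κ V c τ y))
  rcases h : τ s with _ | t
  · have hk : ∀ y, codeKernel κ V c τ s y = ∑ u, κ s u * V s u y := fun y => by
      simp [codeKernel, h]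
    calc _ ≤ -L := by simp only [Option.elim_none]; linarith
      _ = ∑ y, codeKernel κ V c τ s y * (-L) := by rw [← Finset.sum_mul, hK1, one_mul]
      _ ≤ _ := by
        refine Finset.sum_le_sum fun y _ => ?_
        rcases (hK0 s y).eq_or_lt with h0 | h0
        · simp [← h0]
        · refine mul_le_mul_of_nonneg_left ?_ h0.le
          have h1 := Real.logb_nonpos (b := 2) (by norm_num) (hpc0 y) (hpc1 y)
          rw [hk] at h0 ⊢
          have h2 := hfail s y hs h0
          linarith
  · have hk : ∀ y, codeKernel κ V c τ s y = V s (c t) y := fun y => by simp [codeKernel, h]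
    simp only [Option.elim_some]
    have hD0 : ∀ y, 0 ≤ outputBound p κ V M N s (c t) y - p s * V s (c t) y := fun y => by
      have h1 : 0 ≤ outputLaw p κ V y := Finset.sum_nonneg fun s _ =>
        Finset.sum_nonneg fun u _ => mul_nonneg (mul_nonneg (hp s) (hκ s u)) (hV s u y)
      have h2 : 0 ≤ inputOutputLaw p κ V (c t) y := Finset.sum_nonneg fun s _ =>
        mul_nonneg (mul_nonneg (hp s) (hκ s _)) (hV s _ y)
      have h3 := inputLaw_nonneg p κ hp hκ (c t)
      unfold outputBound
      have : 0 ≤ (2 * N / M + 1) * outputLaw p κ V y +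
        inputOutputLaw p κ V (c t) y / (M * inputLaw p κ (c t)) := by positivity
      linarith
    calc _ ≤ ∑ y, (V s (c t) y * A - V s (c t) y * F s (c t) y -
          2 * (V s (c t) y / outputBound p κ V M N s (c t) y * codeOutput p κ V c τ y)) := by
          rw [Finset.sum_sub_distrib, Finset.sum_sub_distrib, ← Finset.sum_mul, hV1, one_mul,
            ← Finset.mul_sum]
          linarith [hF s (c t), hφ s (c t)]
      _ ≤ _ := by
          refine Finset.sum_le_sum fun y _ => ?_
          rw [hk]
          rcases (hV s (c t) y).eq_or_lt with h0 | h0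
          · simp [← h0]
          · have hD : 0 < outputBound p κ V M N s (c t) y := by
              linarith [hD0 y, mul_pos hs h0]
            have h1 := logb_two_sub_le (hpcpos s y hs (by rw [hk]; exact h0)) hD
            set q := codeOutput p κ V c τ y / outputBound p κ V M N s (c t) y with hq
            have hq0 : 0 ≤ q := div_nonneg (hpc0 y) hD.le
            have h2 : (q - 1) / Real.log 2 ≤ 2 * q := by
              rw [div_le_iff₀ (by linarith)]
              nlinarith
            have h3 := hsucc s t y hs h h0
            have h4 : V s (c t) y * A - V s (c t) y * F s (c t) y -
                2 * (V s (c t) y / outputBound p κ V M N s (c t) y * codeOutput p κ V c τ y) =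
                V s (c t) y * (A - F s (c t) y - 2 * q) := by rw [hq]; ring
            rw [h4]
            exact mul_le_mul_of_nonneg_left (by linarith) h0.le

end CodeInformation

/-! ### Product laws on tuples -/

section Tensor

variable {S U Y : Type*} {n : ℕ}

/-- Product of a function over the coordinates of a tuple. -/
def tensor (p : S → ℝ) (s : Fin n → S) : ℝ := ∏ i, p (s i)

/-- Product of a kernel over the coordinates. -/
def tensor₂ (κ : S → U → ℝ) (s : Fin n → S) (u : Fin n → U) : ℝ := ∏ i, κ (s i) (u i)

/-- Product of a two-input kernel over the coordinates. -/
def tensor₃ (V : S → U → Y → ℝ) (s : Fin n → S) (u : Fin n → U) (y : Fin n → Y) : ℝ :=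
  ∏ i, V (s i) (u i) (y i)

variable {p : S → ℝ} {κ : S → U → ℝ} {V : S → U → Y → ℝ}

theorem tensor_nonneg (hp : ∀ s, 0 ≤ p s) (s : Fin n → S) : 0 ≤ tensor p s :=
  Finset.prod_nonneg fun _ _ => hp _

theorem tensor₂_nonneg (hκ : ∀ s u, 0 ≤ κ s u) (s : Fin n → S) (u : Fin n → U) :
    0 ≤ tensor₂ κ s u :=
  Finset.prod_nonneg fun _ _ => hκ _ _

theorem tensor₃_nonneg (hV : ∀ s u y, 0 ≤ V s u y) (s : Fin n → S) (u : Fin n → U)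
    (y : Fin n → Y) : 0 ≤ tensor₃ V s u y :=
  Finset.prod_nonneg fun _ _ => hV _ _ _

theorem pos_of_prod_pos {f : Fin n → ℝ} (hf : ∀ i, 0 ≤ f i) (h : 0 < ∏ i, f i) (i : Fin n) :
    0 < f i :=
  (hf i).lt_of_ne fun h0 => h.ne' (Finset.prod_eq_zero (Finset.mem_univ i) h0.symm)

theorem logb_prod_of_pos {f : Fin n → ℝ} (hf : ∀ i, 0 < f i) :
    Real.logb 2 (∏ i, f i) = ∑ i, Real.logb 2 (f i) :=
  Real.logb_prod _ _ fun i _ => (hf i).ne'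

theorem sum_tensor [Fintype S] (hp1 : ∑ s, p s = 1) : ∑ s : Fin n → S, tensor p s = 1 := by
  simp only [tensor]
  rw [sum_tuple_prod (fun _ => p)]; simp [hp1]

theorem sum_tensor₂ [Fintype U] (hκ1 : ∀ s, ∑ u, κ s u = 1) (s : Fin n → S) :
    ∑ u : Fin n → U, tensor₂ κ s u = 1 := by
  simp only [tensor₂]
  rw [sum_tuple_prod (fun i => κ (s i))]; simp [hκ1]

theorem sum_tensor₃ [Fintype Y] (hV1 : ∀ s u, ∑ y, V s u y = 1) (s : Fin n → S) (u : Fin n → U) :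
    ∑ y : Fin n → Y, tensor₃ V s u y = 1 := by
  simp only [tensor₃]
  rw [sum_tuple_prod (fun i => V (s i) (u i))]; simp [hV1]

theorem inputLaw_tensor [Fintype S] (p : S → ℝ) (κ : S → U → ℝ) (u : Fin n → U) :
    inputLaw (tensor p) (tensor₂ κ) u = ∏ i, inputLaw p κ (u i) := by
  simp only [inputLaw, tensor, tensor₂, ← Finset.prod_mul_distrib]
  rw [sum_tuple_prod (fun i s => p s * κ s (u i))]

theorem inputOutputLaw_tensor [Fintype S] (p : S → ℝ) (κ : S → U → ℝ) (V : S → U → Y → ℝ)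
    (u : Fin n → U) (y : Fin n → Y) :
    inputOutputLaw (tensor p) (tensor₂ κ) (tensor₃ V) u y =
      ∏ i, inputOutputLaw p κ V (u i) (y i) := by
  simp only [inputOutputLaw, tensor, tensor₂, tensor₃, ← Finset.prod_mul_distrib]
  rw [sum_tuple_prod (fun i s => p s * κ s (u i) * V s (u i) (y i))]

theorem sum_tensor₂_mul_tensor₃ [Fintype U] (κ : S → U → ℝ) (V : S → U → Y → ℝ)
    (s : Fin n → S) (y : Fin n → Y) :
    ∑ u, tensor₂ κ s u * tensor₃ V s u y = ∏ i, ∑ u, κ (s i) u * V (s i) u (y i) := by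
  simp only [tensor₂, tensor₃, ← Finset.prod_mul_distrib]
  rw [sum_tuple_prod (fun i u => κ (s i) u * V (s i) u (y i))]

theorem outputLaw_tensor [Fintype S] [Fintype U] (p : S → ℝ) (κ : S → U → ℝ) (V : S → U → Y → ℝ)
    (y : Fin n → Y) :
    outputLaw (tensor p) (tensor₂ κ) (tensor₃ V) y = ∏ i, outputLaw p κ V (y i) := by
  have h : ∀ y, outputLaw p κ V y = ∑ s, p s * ∑ u, κ s u * V s u y := fun y => by
    simp only [outputLaw, Finset.mul_sum, mul_assoc]
  simp only [outputLaw, mul_assoc, ← Finset.mul_sum, sum_tensor₂_mul_tensor₃]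
  simp only [tensor, ← Finset.prod_mul_distrib]
  rw [sum_tuple_prod (fun i s => p s * ∑ u, κ s u * V s u (y i))]

end Tensor

/-! ### Information densities along tuples -/

section Densities

variable {S U Y : Type*} [Fintype S] (p : S → ℝ) (κ : S → U → ℝ)
  (V : S → U → Y → ℝ)

/-- Information density between codeword and state. -/
def inputDensity (s : S) (u : U) : ℝ := Real.logb 2 (κ s u) - Real.logb 2 (inputLaw p κ u)

/-- Information density between the pair of state and codeword and the output. -/
def outputDensity [Fintype U] (s : S) (u : U) (y : Y) : ℝ :=
  Real.logb 2 (V s u y) - Real.logb 2 (outputLaw p κ V y)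

/-- Conditional information density between state and output given the codeword. -/
def condDensity (s : S) (u : U) (y : Y) : ℝ :=
  Real.logb 2 (V s u y) + Real.logb 2 (inputLaw p κ u) - Real.logb 2 (inputOutputLaw p κ V u y)

/-- Mean with respect to the joint law. -/
def jointMean [Fintype U] [Fintype Y] (f : S → U → Y → ℝ) : ℝ :=
  ∑ s, ∑ u, ∑ y, p s * κ s u * V s u y * f s u y

/-- Deviation of the sum of `f` along a tuple from `n` times `m`. -/
def deviation {n : ℕ} (f : S → U → Y → ℝ) (m : ℝ) (s : Fin n → S) (u : Fin n → U)
    (y : Fin n → Y) : ℝ :=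
  |∑ i, f (s i) (u i) (y i) - n * m|

omit [Fintype S] in
theorem deviation_nonneg {n : ℕ} (f : S → U → Y → ℝ) (m : ℝ) (s : Fin n → S) (u : Fin n → U)
    (y : Fin n → Y) : 0 ≤ deviation f m s u y := abs_nonneg _

omit [Fintype S] in
theorem deviation_le {n : ℕ} {f : S → U → Y → ℝ} {m C : ℝ} (hC : ∀ s u y, |f s u y - m| ≤ C)
    (s : Fin n → S) (u : Fin n → U) (y : Fin n → Y) : deviation f m s u y ≤ n * C := by
  have h : ∑ i, f (s i) (u i) (y i) - n * m = ∑ i, (f (s i) (u i) (y i) - m) := by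
    rw [Finset.sum_sub_distrib]; simp
  rw [deviation, h]
  refine (Finset.abs_sum_le_sum_abs _ _).trans ?_
  refine (Finset.sum_le_sum fun i _ => hC _ _ _).trans ?_
  simp

variable {p κ V}

theorem mean_deviation_le [Fintype U] [Fintype Y] (hp : ∀ s, 0 ≤ p s) (hp1 : ∑ s, p s = 1)
    (hκ : ∀ s u, 0 ≤ κ s u)
    (hκ1 : ∀ s, ∑ u, κ s u = 1) (hV : ∀ s u y, 0 ≤ V s u y) (hV1 : ∀ s u, ∑ y, V s u y = 1)
    {f : S → U → Y → ℝ} {C : ℝ} (hC0 : 0 ≤ C) (hC : ∀ s u y, |f s u y - jointMean p κ V f| ≤ C)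
    (n : ℕ) :
    ∑ s : Fin n → S, ∑ u : Fin n → U, tensor p s * tensor₂ κ s u *
      ∑ y, tensor₃ V s u y * deviation f (jointMean p κ V f) s u y ≤ C * Real.sqrt n := by
  have := sum_abs_dev_triple_le p κ V f
    (fun s u b => mul_nonneg (mul_nonneg (hp s) (hκ s u)) (hV s u b))
    (by simp [← Finset.mul_sum, hV1, hκ1, hp1]) (m := jointMean p κ V f) rfl hC hC0 n
  refine le_trans (le_of_eq ?_) this
  refine Finset.sum_congr rfl fun s _ => Finset.sum_congr rfl fun u _ => ?_
  rw [Finset.mul_sum]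
  refine Finset.sum_congr rfl fun y _ => ?_
  simp only [tensor, tensor₂, tensor₃, deviation]
  ring

theorem inputLaw_pos (hp : ∀ s, 0 ≤ p s) (hκ : ∀ s u, 0 ≤ κ s u) {s : S} {u : U} (h : 0 < p s)
    (h' : 0 < κ s u) : 0 < inputLaw p κ u :=
  (mul_pos h h').trans_le (Finset.single_le_sum (f := fun s => p s * κ s u)
    (fun s _ => mul_nonneg (hp s) (hκ s u)) (Finset.mem_univ s))

theorem inputOutputLaw_pos (hp : ∀ s, 0 ≤ p s) (hκ : ∀ s u, 0 ≤ κ s u)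
    (hV : ∀ s u y, 0 ≤ V s u y) {s : S} {u : U} {y : Y}
    (h : 0 < p s) (h' : 0 < κ s u) (h'' : 0 < V s u y) : 0 < inputOutputLaw p κ V u y :=
  (mul_pos (mul_pos h h') h'').trans_le
    (Finset.single_le_sum (f := fun s => p s * κ s u * V s u y)
    (fun s _ => mul_nonneg (mul_nonneg (hp s) (hκ s u)) (hV s u y)) (Finset.mem_univ s))

theorem outputLaw_pos_of_pos [Fintype U] (hp : ∀ s, 0 ≤ p s) (hκ : ∀ s u, 0 ≤ κ s u)
    (hV : ∀ s u y, 0 ≤ V s u y) {s : S} {y : Y}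
    (h : 0 < p s) (h' : 0 < ∑ u, κ s u * V s u y) : 0 < outputLaw p κ V y := by
  have e : outputLaw p κ V y = ∑ s, p s * ∑ u, κ s u * V s u y := by
    simp only [outputLaw, Finset.mul_sum, mul_assoc]
  rw [e]
  exact (mul_pos h h').trans_le
    (Finset.single_le_sum (f := fun s => p s * ∑ u, κ s u * V s u y)
    (fun s _ => mul_nonneg (hp s) (Finset.sum_nonneg fun u _ => mul_nonneg (hκ s u) (hV s u y)))
    (Finset.mem_univ s))

omit [Fintype S] in
theorem sum_mul_pos [Fintype U] (hκ : ∀ s u, 0 ≤ κ s u) (hV : ∀ s u y, 0 ≤ V s u y) {s : S}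
    {u : U} {y : Y} (h' : 0 < κ s u) (h'' : 0 < V s u y) : 0 < ∑ u, κ s u * V s u y :=
  (mul_pos h' h'').trans_le (Finset.single_le_sum (f := fun u => κ s u * V s u y)
    (fun u _ => mul_nonneg (hκ s u) (hV s u y)) (Finset.mem_univ u))

section

variable [Fintype U] {n : ℕ} (hp : ∀ s, 0 ≤ p s) (hκ : ∀ s u, 0 ≤ κ s u)
  (hV : ∀ s u y, 0 ≤ V s u y)
include hp hκ hV

theorem logb_tensor₃_sub_outputLaw {s : Fin n → S} {u : Fin n → U} {y : Fin n → Y}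
    (h : 0 < tensor p s) (h' : 0 < tensor₂ κ s u) (h'' : 0 < tensor₃ V s u y) :
    0 < outputLaw (tensor p) (tensor₂ κ) (tensor₃ V) y ∧
    Real.logb 2 (tensor₃ V s u y) -
      Real.logb 2 (outputLaw (tensor p) (tensor₂ κ) (tensor₃ V) y) =
      ∑ i, outputDensity p κ V (s i) (u i) (y i) := by
  have h1 := pos_of_prod_pos (fun i => hp (s i)) h
  have h2 := pos_of_prod_pos (fun i => hκ (s i) (u i)) h'
  have h3 := pos_of_prod_pos (fun i => hV (s i) (u i) (y i)) h''
  have h4 : ∀ i, 0 < outputLaw p κ V (y i) := fun i =>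
    outputLaw_pos_of_pos hp hκ hV (h1 i) (sum_mul_pos hκ hV (h2 i) (h3 i))
  rw [outputLaw_tensor]
  refine ⟨Finset.prod_pos fun i _ => h4 i, ?_⟩
  rw [tensor₃, logb_prod_of_pos h3, logb_prod_of_pos h4, ← Finset.sum_sub_distrib]
  rfl

omit [Fintype U] in
theorem logb_tensor₃_sub_cond {s : Fin n → S} {u : Fin n → U} {y : Fin n → Y}
    (h : 0 < tensor p s) (h' : 0 < tensor₂ κ s u) (h'' : 0 < tensor₃ V s u y) :
    0 < inputOutputLaw (tensor p) (tensor₂ κ) (tensor₃ V) u y ∧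
    0 < inputLaw (tensor p) (tensor₂ κ) u ∧
    Real.logb 2 (tensor₃ V s u y) + Real.logb 2 (inputLaw (tensor p) (tensor₂ κ) u) -
      Real.logb 2 (inputOutputLaw (tensor p) (tensor₂ κ) (tensor₃ V) u y) =
      ∑ i, condDensity p κ V (s i) (u i) (y i) := by
  have h1 := pos_of_prod_pos (fun i => hp (s i)) h
  have h2 := pos_of_prod_pos (fun i => hκ (s i) (u i)) h'
  have h3 := pos_of_prod_pos (fun i => hV (s i) (u i) (y i)) h''
  have h4 : ∀ i, 0 < inputOutputLaw p κ V (u i) (y i) := fun i =>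
    inputOutputLaw_pos hp hκ hV (h1 i) (h2 i) (h3 i)
  have h5 : ∀ i, 0 < inputLaw p κ (u i) := fun i => inputLaw_pos hp hκ (h1 i) (h2 i)
  rw [inputOutputLaw_tensor, inputLaw_tensor]
  refine ⟨Finset.prod_pos fun i _ => h4 i, Finset.prod_pos fun i _ => h5 i, ?_⟩
  rw [tensor₃, logb_prod_of_pos h3, logb_prod_of_pos h4, logb_prod_of_pos h5,
    ← Finset.sum_add_distrib, ← Finset.sum_sub_distrib]
  rfl

/-- Crude bounds for failed states: the output law is then a product of single-letter mixtures, so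
the logarithms grow at most linearly in n. -/
theorem abs_logb_sum_tensor_le [Fintype Y] {L : ℝ}
    (hL : ∀ s y, |Real.logb 2 (∑ u, κ s u * V s u y)| + |Real.logb 2 (outputLaw p κ V y)| ≤ L)
    {s : Fin n → S} {y : Fin n → Y} (h : 0 < tensor p s)
    (h' : 0 < ∑ u, tensor₂ κ s u * tensor₃ V s u y) :
    0 < outputLaw (tensor p) (tensor₂ κ) (tensor₃ V) y ∧
    -(n * L) ≤ Real.logb 2 (∑ u, tensor₂ κ s u * tensor₃ V s u y) ∧
    Real.logb 2 (∑ u, tensor₂ κ s u * tensor₃ V s u y) -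
      Real.logb 2 (outputLaw (tensor p) (tensor₂ κ) (tensor₃ V) y) ≤ n * L := by
  have h1 := pos_of_prod_pos (fun i => hp (s i)) h
  rw [sum_tensor₂_mul_tensor₃] at h' ⊢
  have h2 := pos_of_prod_pos (fun i => Finset.sum_nonneg fun u _ =>
    mul_nonneg (hκ (s i) u) (hV (s i) u (y i))) h'
  have h4 : ∀ i, 0 < outputLaw p κ V (y i) := fun i =>
    outputLaw_pos_of_pos hp hκ hV (h1 i) (h2 i)
  rw [outputLaw_tensor, logb_prod_of_pos h2, logb_prod_of_pos h4]
  refine ⟨Finset.prod_pos fun i _ => h4 i, ?_, ?_⟩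
  · have : ∑ _i : Fin n, (-L) ≤ ∑ i, Real.logb 2 (∑ u, κ (s i) u * V (s i) u (y i)) := by
      refine Finset.sum_le_sum fun i _ => ?_
      have := hL (s i) (y i)
      have h5 := neg_abs_le (Real.logb 2 (∑ u, κ (s i) u * V (s i) u (y i)))
      linarith [abs_nonneg (Real.logb 2 (outputLaw p κ V (y i)))]
    simpa using this
  · rw [← Finset.sum_sub_distrib]
    have : ∑ i, (Real.logb 2 (∑ u, κ (s i) u * V (s i) u (y i)) -
        Real.logb 2 (outputLaw p κ V (y i))) ≤ ∑ _i : Fin n, L := by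
      refine Finset.sum_le_sum fun i _ => ?_
      have := hL (s i) (y i)
      have h5 := le_abs_self (Real.logb 2 (∑ u, κ (s i) u * V (s i) u (y i)))
      have h6 := neg_abs_le (Real.logb 2 (outputLaw p κ V (y i)))
      linarith
    simpa using this

/-- Exponential bound for `outputBound` along tuples. -/
theorem logb_outputBound_le {M x A T : ℝ} {N : ℕ} (hM : 0 < M) (hx : 0 ≤ x)
    (hN : (N : ℝ) ≤ 2 * (M * 2 ^ x)) {s : Fin n → S} {u : Fin n → U} {y : Fin n → Y}
    (h : 0 < tensor p s) (h' : 0 < tensor₂ κ s u) (h'' : 0 < tensor₃ V s u y)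
    (h1 : ∑ i, Real.logb 2 (p (s i)) ≤ T - A)
    (h2 : -∑ i, outputDensity p κ V (s i) (u i) (y i) ≤ T - A)
    (h3 : -∑ i, condDensity p κ V (s i) (u i) (y i) - Real.logb 2 M ≤ T - A) :
    Real.logb 2 (outputBound (tensor p) (tensor₂ κ) (tensor₃ V) M N s u y) -
      Real.logb 2 (tensor₃ V s u y) ≤ T - (A - x - 3) := by
  have hb : (1 : ℝ) < 2 := by norm_num
  set v := tensor₃ V s u y with hv
  have e0 : (2 : ℝ) ^ (Real.logb 2 v) = v := Real.rpow_logb (by norm_num) (by norm_num) h''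
  have t1 : tensor p s ≤ 2 ^ (T - A) := by
    rw [← Real.logb_le_iff_le_rpow hb h, tensor,
      logb_prod_of_pos (pos_of_prod_pos (fun i => hp (s i)) h)]
    exact h1
  have t2 : outputLaw (tensor p) (tensor₂ κ) (tensor₃ V) y ≤ v * 2 ^ (T - A) := by
    obtain ⟨hpos, hlog⟩ := logb_tensor₃_sub_outputLaw hp hκ hV h h' h''
    nth_rewrite 1 [← e0]
    rw [← Real.rpow_add (by norm_num), ← Real.logb_le_iff_le_rpow hb hpos]
    linarith
  have t3 : inputOutputLaw (tensor p) (tensor₂ κ) (tensor₃ V) u y /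
      (M * inputLaw (tensor p) (tensor₂ κ) u) ≤ v * 2 ^ (T - A) := by
    obtain ⟨hpos, hpos', hlog⟩ := logb_tensor₃_sub_cond hp hκ hV h h' h''
    nth_rewrite 1 [← e0]
    rw [← Real.rpow_add (by norm_num), ← Real.logb_le_iff_le_rpow hb (by positivity),
      Real.logb_div hpos.ne' (by positivity), Real.logb_mul hM.ne' hpos'.ne']
    linarith
  have hx1 : (1 : ℝ) ≤ 2 ^ x := Real.one_le_rpow hb.le hx
  have hNM : 2 * (N : ℝ) / M + 1 ≤ 5 * 2 ^ x := by
    have : 2 * (N : ℝ) / M ≤ 4 * 2 ^ x := by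
      rw [div_le_iff₀ hM]; linarith
    linarith
  -- The terms add up to at most (1 + 5·2^x + 1) ≤ 2^(x+3) copies of the common bound, hence the
  -- constant 3.
  have hD : outputBound (tensor p) (tensor₂ κ) (tensor₃ V) M N s u y ≤
      2 ^ (Real.logb 2 v + (T - A) + x + 3) := by
    rw [Real.rpow_add (by norm_num), Real.rpow_add (by norm_num), Real.rpow_add (by norm_num), e0]
    have h8 : (2 : ℝ) ^ (3 : ℝ) = 8 := by norm_num
    rw [h8]
    have hw : 0 ≤ v * 2 ^ (T - A) := by positivity
    unfold outputBound
    have a1 := mul_le_mul_of_nonneg_right t1 h''.le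
    have hNM0 : 0 ≤ 2 * (N : ℝ) / M + 1 := by positivity
    have a2 := mul_le_mul hNM t2 (outputLaw_tensor p κ V y ▸
      (logb_tensor₃_sub_outputLaw hp hκ hV h h' h'').1.le) (by positivity)
    have a3 : v * 2 ^ (T - A) ≤ v * 2 ^ (T - A) * 2 ^ x := le_mul_of_one_le_right hw hx1
    nlinarith
  have hDpos : 0 < outputBound (tensor p) (tensor₂ κ) (tensor₃ V) M N s u y := by
    unfold outputBound
    have b1 := (logb_tensor₃_sub_outputLaw hp hκ hV h h' h'').1
    obtain ⟨b2, b3, -⟩ := logb_tensor₃_sub_cond hp hκ hV h h' h''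
    positivity
  rw [← Real.logb_le_iff_le_rpow hb hDpos] at hD
  linarith

end

end Densities

/-! ### Block codes and their rates -/

section BlockCode

variable {S U Y Z : Type*} [Fintype S] [Fintype U] [Fintype Y] [Fintype Z]
  {p : S → ℝ} {κ : S → U → ℝ} {V : S → U → Y → ℝ}

/-- Conditional mean of the deviation given state and codeword. -/
def meanDeviation {n : ℕ} (V : S → U → Y → ℝ) (f : S → U → Y → ℝ) (m : ℝ) (s : Fin n → S)
    (u : Fin n → U) : ℝ :=
  ∑ y, tensor₃ V s u y * deviation f m s u y

omit [Fintype S] [Fintype U] in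
theorem meanDeviation_nonneg {n : ℕ} (hV : ∀ s u y, 0 ≤ V s u y) (f : S → U → Y → ℝ) (m : ℝ)
    (s : Fin n → S) (u : Fin n → U) : 0 ≤ meanDeviation V f m s u :=
  Finset.sum_nonneg fun y _ => mul_nonneg (tensor₃_nonneg hV s u y) (deviation_nonneg f m s u y)

omit [Fintype S] [Fintype U] in
theorem meanDeviation_le {n : ℕ} (hV : ∀ s u y, 0 ≤ V s u y) (hV1 : ∀ s u, ∑ y, V s u y = 1)
    {f : S → U → Y → ℝ} {m C : ℝ} (hC : ∀ s u y, |f s u y - m| ≤ C)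
    (s : Fin n → S) (u : Fin n → U) : meanDeviation V f m s u ≤ n * C := by
  calc _ ≤ ∑ y, tensor₃ V s u y * (n * C) := Finset.sum_le_sum fun y _ =>
        mul_le_mul_of_nonneg_left (deviation_le hC s u y) (tensor₃_nonneg hV s u y)
    _ = n * C := by rw [← Finset.sum_mul, sum_tensor₃ hV1, one_mul]

theorem exists_abs_sub_le (f : S → U → Y → ℝ) (m : ℝ) :
    ∃ C, 0 ≤ C ∧ ∀ s u y, |f s u y - m| ≤ C := by
  obtain ⟨C, hC⟩ := Finite.exists_le (fun r : S × U × Y => |f r.1 r.2.1 r.2.2 - m|)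
  exact ⟨max C 0, le_max_right _ _, fun s u y => (hC (s, u, y)).trans (le_max_left _ _)⟩

/-- Markov's inequality: since R ≥ 0, a pair cut off by the truncation has input density exceeding
its mean by at least nδ. -/
theorem one_sub_typicalMass_le (hp : ∀ s, 0 ≤ p s) (hp1 : ∑ s, p s = 1)
    (hκ : ∀ s u, 0 ≤ κ s u) (hκ1 : ∀ s, ∑ u, κ s u = 1) (hV : ∀ s u y, 0 ≤ V s u y)
    (hV1 : ∀ s u, ∑ y, V s u y = 1) {R δ C : ℝ} (hR : 0 ≤ R) (hC0 : 0 ≤ C)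
    (hC : ∀ s u (_ : Y), |inputDensity p κ s u -
      jointMean p κ V (fun s u _ => inputDensity p κ s u)| ≤ C) {n : ℕ} (hn : 0 < n * δ) :
    1 - ∑ s : Fin n → S, tensor p s * typicalMass (tensor p) (tensor₂ κ)
      (2 ^ (n * (jointMean p κ V (fun s u _ => inputDensity p κ s u) + R + δ))) s ≤
      C * Real.sqrt n / (n * δ) := by
  set m := jointMean p κ V (fun s u _ => inputDensity p κ s u) with hm
  set M : ℝ := 2 ^ (n * (m + R + δ)) with hM
  have hM0 : 0 < M := by positivity
  have hone : (1 : ℝ) = ∑ s : Fin n → S, ∑ u : Fin n → U, tensor p s * tensor₂ κ s u := by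
    simp only [← Finset.mul_sum, sum_tensor₂ hκ1, mul_one, sum_tensor hp1]
  have hdev := mean_deviation_le hp hp1 hκ hκ1 hV hV1 hC0 hC n
  rw [hone]
  simp only [typicalMass, Finset.mul_sum, ← Finset.sum_sub_distrib]
  rw [le_div_iff₀ hn]
  refine le_trans ?_ hdev
  rw [Finset.sum_mul]
  refine Finset.sum_le_sum fun s _ => ?_
  rw [Finset.sum_mul]
  refine Finset.sum_le_sum fun u _ => ?_
  have hps := tensor_nonneg hp s
  have hκs := tensor₂_nonneg hκ s u
  have hmd := meanDeviation_nonneg hV (fun s u _ => inputDensity p κ s u) m s u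
  simp only [meanDeviation] at hmd
  rw [← hm]
  split_ifs with h
  · rw [sub_self, zero_mul]
    exact mul_nonneg (mul_nonneg hps hκs) hmd
  · rw [mul_zero, sub_zero]
    rcases hps.eq_or_lt with h0 | h0
    · simp [← h0]
    rcases hκs.eq_or_lt with h0' | h0'
    · simp [← h0']
    refine mul_le_mul_of_nonneg_left ?_ (mul_nonneg hps hκs)
    have hd : ∀ y : Fin n → Y, deviation (fun s u _ => inputDensity p κ s u) m s u y =
        |∑ i, inputDensity p κ (s i) (u i) - n * m| := fun y => rfl
    simp only [hd, ← Finset.sum_mul, sum_tensor₃ hV1, one_mul]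
    have h1 := pos_of_prod_pos (fun i => hp (s i)) h0
    have h2 := pos_of_prod_pos (fun i => hκ (s i) (u i)) h0'
    have h5 : ∀ i, 0 < inputLaw p κ (u i) := fun i => inputLaw_pos hp hκ (h1 i) (h2 i)
    have hL : 0 < inputLaw (tensor p) (tensor₂ κ) u := inputLaw_pos (tensor_nonneg hp)
      (tensor₂_nonneg hκ) h0 h0'
    have hlt := Real.logb_lt_logb (b := 2) (by norm_num) (mul_pos hM0 hL) (not_le.1 h)
    rw [Real.logb_mul hM0.ne' hL.ne', hM, Real.logb_rpow (by norm_num) (by norm_num),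
      inputLaw_tensor, logb_prod_of_pos h5, tensor₂, logb_prod_of_pos h2] at hlt
    simp only [inputDensity, Finset.sum_sub_distrib]
    refine le_trans ?_ (le_abs_self _)
    have : 0 ≤ n * R := by positivity
    linarith

/-- The output law induced by choosing a codeword uniformly, with one extra share of the law of the
output. -/
def codebookOutput (p : S → ℝ) (κ : S → U → ℝ) (V : S → U → Y → ℝ) {N : ℕ} (c : Fin N → U)
    (y : Y) : ℝ :=
  (∑ t, inputOutputLaw p κ V (c t) y / inputLaw p κ (c t) + outputLaw p κ V y) / (N + 1)

omit [Fintype Y] in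
theorem codebookOutput_terms_nonneg (hp : ∀ s, 0 ≤ p s) (hκ : ∀ s u, 0 ≤ κ s u)
    (hV : ∀ s u y, 0 ≤ V s u y) (y : Y) : (∀ u, 0 ≤ inputOutputLaw p κ V u y / inputLaw p κ u) ∧
      0 ≤ outputLaw p κ V y :=
  ⟨fun u => div_nonneg (Finset.sum_nonneg fun s _ =>
      mul_nonneg (mul_nonneg (hp s) (hκ s u)) (hV s u y)) (inputLaw_nonneg p κ hp hκ u),
    Finset.sum_nonneg fun s _ =>
      Finset.sum_nonneg fun u _ => mul_nonneg (mul_nonneg (hp s) (hκ s u)) (hV s u y)⟩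

theorem sum_outputLaw (hp1 : ∑ s, p s = 1) (hκ1 : ∀ s, ∑ u, κ s u = 1)
    (hV1 : ∀ s u, ∑ y, V s u y = 1) : ∑ y, outputLaw p κ V y = 1 := by
  simp only [outputLaw]
  rw [Finset.sum_comm]
  have : ∀ s, ∑ y, ∑ u, p s * κ s u * V s u y = p s := fun s => by
    rw [Finset.sum_comm]; simp [← Finset.mul_sum, hV1, hκ1]
  simp [this, hp1]

theorem sum_codebookOutput_le (hp1 : ∑ s, p s = 1) (hκ1 : ∀ s, ∑ u, κ s u = 1)
    (hV1 : ∀ s u, ∑ y, V s u y = 1) {N : ℕ} (c : Fin N → U) :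
    ∑ y, codebookOutput p κ V c y ≤ 1 := by
  simp only [codebookOutput]
  rw [← Finset.sum_div, Finset.sum_add_distrib, Finset.sum_comm, sum_outputLaw hp1 hκ1 hV1,
    div_le_one (by positivity)]
  have h : ∀ u, ∑ y, inputOutputLaw p κ V u y / inputLaw p κ u ≤ 1 := fun u => by
    rw [← Finset.sum_div]
    simp only [inputOutputLaw]
    rw [Finset.sum_comm]
    simp only [← Finset.mul_sum, hV1, mul_one]
    exact div_self_le_one _
  have := Finset.sum_le_sum fun t (_ : t ∈ Finset.univ) => h (c t)
  simp only [Finset.sum_const, Finset.card_univ, Fintype.card_fin, nsmul_eq_mul, mul_one] at this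
  linarith

/-- Keeping one of the N + 1 shares of the mixture costs log₂(N + 1). The share is the sent
codeword's on success and `outputLaw` on failure. -/
theorem logb_sub_codebookOutput_le {N : ℕ} {q x : ℝ} {v : ℝ} (hx : 0 < x)
    (hq : x / (N + 1) ≤ q) : 0 < q ∧
    Real.logb 2 v - Real.logb 2 q ≤ Real.logb 2 (N + 1) + (Real.logb 2 v - Real.logb 2 x) := by
  have hN : (0 : ℝ) < N + 1 := by positivity
  have hxN : 0 < x / (N + 1) := by positivity
  refine ⟨hxN.trans_le hq, ?_⟩
  have := Real.logb_le_logb_of_le (b := 2) (by norm_num) hxN hq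
  rw [Real.logb_div hx.ne' hN.ne'] at this
  linarith

/-- Decay of order 1/x is enough: x will be nδ, and the failure cost is linear in n. -/
theorem exp_neg_div_le {M x : ℝ} {N : ℕ} (hM : 0 < M) (hx : 0 < x) (hN : M * 2 ^ x ≤ N) :
    Real.exp (-(N / M)) ≤ 2 / x := by
  have h1 : (2 : ℝ) ^ x ≤ N / M := by rw [le_div_iff₀ hM]; linarith
  have h2 : x / 2 ≤ (2 : ℝ) ^ x := by
    rw [Real.rpow_def_of_pos (by norm_num)]
    have := Real.add_one_le_exp (Real.log 2 * x)
    have hl := Real.log_two_gt_d9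
    nlinarith
  have h3 := Real.add_one_le_exp (N / M : ℝ)
  rw [Real.exp_neg]
  calc _ ≤ (x / 2)⁻¹ := inv_anti₀ (by positivity) (by linarith)
    _ = _ := inv_div _ _

set_option maxHeartbeats 2000000 in
-- Raising R enlarges M and N together: fewer states share a codeword, so Y^n reveals more of S^n,
-- while the codebook bound for Z^n grows by the same R. The three conditions on A are the exponents
-- of the terms of `outputBound`.
theorem exists_code_bounds {W : S → U → Z → ℝ} (hp : ∀ s, 0 ≤ p s) (hp1 : ∑ s, p s = 1)
    (hκ : ∀ s u, 0 ≤ κ s u) (hκ1 : ∀ s, ∑ u, κ s u = 1) (hV : ∀ s u y, 0 ≤ V s u y)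
    (hV1 : ∀ s u, ∑ y, V s u y = 1) (hW : ∀ s u z, 0 ≤ W s u z)
    (hW1 : ∀ s u, ∑ z, W s u z = 1) {mU R A δ : ℝ} (hR : 0 ≤ R) (hδ : 0 < δ)
    (hmU : jointMean p κ V (fun s u _ => inputDensity p κ s u) = mU) (hmU0 : 0 ≤ mU)
    (hA1 : A ≤ -jointMean p κ V (fun s _ _ => Real.logb 2 (p s)))
    (hA2 : A ≤ jointMean p κ V (outputDensity p κ V))
    (hA3 : A ≤ jointMean p κ V (fun s u y => condDensity p κ V s u y) + mU + R) :
    ∃ K : ℝ, ∀ n : ℕ, 1 ≤ n * δ → ∃ (N : ℕ) (c : Fin N → Fin n → U)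
      (τ : (Fin n → S) → Option (Fin N)),
      n * A - 2 * n * δ - 3 - K * (Real.sqrt n + 1) ≤
        channelInfo (tensor p) (codeKernel (tensor₂ κ) (tensor₃ V) c τ) ∧
      channelInfo (tensor p) (codeKernel (tensor₂ κ) (tensor₃ W) c τ) ≤
        n * jointMean p κ W (outputDensity p κ W) + K * (Real.sqrt n + 1) ∧
      channelInfo (tensor p) (codeKernel (tensor₂ κ) (tensor₃ W) c τ) ≤
        n * (mU + R + jointMean p κ W (fun s u y => condDensity p κ W s u y)) + 2 * n * δ + 3 +
          K * (Real.sqrt n + 1) := by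
  set m₁ := jointMean p κ V (fun s _ _ => Real.logb 2 (p s)) with hm₁
  set m₂ := jointMean p κ V (outputDensity p κ V) with hm₂
  set m₃ := jointMean p κ V (fun s u y => condDensity p κ V s u y) with hm₃
  set m₄ := jointMean p κ W (outputDensity p κ W) with hm₄
  set m₅ := jointMean p κ W (fun s u y => condDensity p κ W s u y) with hm₅
  obtain ⟨C₁, hC₁0, hC₁⟩ := exists_abs_sub_le (fun (s : S) (_ : U) (_ : Y) => Real.logb 2 (p s)) m₁
  obtain ⟨C₂, hC₂0, hC₂⟩ := exists_abs_sub_le (outputDensity p κ V) m₂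
  obtain ⟨C₃, hC₃0, hC₃⟩ := exists_abs_sub_le (fun s u y => condDensity p κ V s u y) m₃
  obtain ⟨C₄, hC₄0, hC₄⟩ := exists_abs_sub_le (outputDensity p κ W) m₄
  obtain ⟨C₅, hC₅0, hC₅⟩ := exists_abs_sub_le (fun s u y => condDensity p κ W s u y) m₅
  obtain ⟨C₆, hC₆0, hC₆⟩ := exists_abs_sub_le (fun s u (_ : Y) => inputDensity p κ s u) mU
  obtain ⟨LY, hLY⟩ := Finite.exists_le (fun r : S × Y =>
    |Real.logb 2 (∑ u, κ r.1 u * V r.1 u r.2)| + |Real.logb 2 (outputLaw p κ V r.2)|)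
  obtain ⟨LZ, hLZ⟩ := Finite.exists_le (fun r : S × Z =>
    |Real.logb 2 (∑ u, κ r.1 u * W r.1 u r.2)| + |Real.logb 2 (outputLaw p κ W r.2)|)
  set C := C₁ + C₂ + C₃ + C₄ + C₅ with hC
  have hC0 : 0 ≤ C := by positivity
  -- The failure charge nD must dominate φ and absorb the crude logarithmic bounds in all three
  -- estimates.
  set D := C + |A| + |LY| + |LZ| + |m₄| + |m₅| with hD
  have hD0 : 0 ≤ D := by positivity
  -- In order: fluctuations, atypical pairs, the remaining failures, and the output ratio.
  set K := C + 2 * C₆ * D / δ + 2 * D / δ + 1 with hK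
  have hK0 : 0 ≤ K := by positivity
  -- The factor 2 is the one in front of the mean in `le_channelInfo_code`.
  refine ⟨2 * K, fun n hn => ?_⟩
  have hn0 : (0 : ℝ) < n := by
    rcases (Nat.cast_nonneg n : (0 : ℝ) ≤ n).eq_or_lt with h | h
    · rw [← h] at hn; norm_num at hn
    · exact h
  set M : ℝ := 2 ^ (n * (mU + R + δ)) with hM
  have hM2 : 2 ≤ M := by
    have h1 : (1 : ℝ) ≤ n * (mU + R + δ) := by nlinarith
    calc (2 : ℝ) = 2 ^ (1 : ℝ) := by norm_num
      _ ≤ M := Real.rpow_le_rpow_of_exponent_le (by norm_num) h1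
  have hM0 : 0 < M := by linarith
  have hx1 : (1 : ℝ) ≤ 2 ^ (n * δ) := Real.one_le_rpow (by norm_num) (by positivity)
  set N := ⌈M * 2 ^ (n * δ)⌉₊ with hN
  have hNlow : M * 2 ^ (n * δ) ≤ N := Nat.le_ceil _
  have hMx : 2 ≤ M * 2 ^ (n * δ) := by nlinarith
  have hNup : (N : ℝ) ≤ M * 2 ^ (n * δ) + 1 := (Nat.ceil_lt_add_one (by linarith)).le
  have hlogM : Real.logb 2 M = n * (mU + R + δ) := Real.logb_rpow (by norm_num) (by norm_num)
  have hlogN : Real.logb 2 (N + 1) ≤ n * (mU + R) + 2 * n * δ + 1 := by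
    rw [Real.logb_le_iff_le_rpow (by norm_num) (by positivity)]
    have : (2 : ℝ) ^ (n * (mU + R) + 2 * n * δ + 1) = M * 2 ^ (n * δ) * 2 := by
      rw [hM, ← Real.rpow_add (by norm_num), ← Real.rpow_add_one (by norm_num)]
      congr 1; ring
    rw [this]; linarith
  -- All five deviations are summed so that the same code serves both receivers.
  let φ : (Fin n → S) → (Fin n → U) → ℝ := fun s u =>
    meanDeviation V (fun s _ _ => Real.logb 2 (p s)) m₁ s u +
    meanDeviation V (outputDensity p κ V) m₂ s u +
    meanDeviation V (fun s u y => condDensity p κ V s u y) m₃ s u +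
    meanDeviation W (outputDensity p κ W) m₄ s u +
    meanDeviation W (fun s u y => condDensity p κ W s u y) m₅ s u
  have d1 := fun s u => meanDeviation_nonneg (n := n) hV (fun s _ _ => Real.logb 2 (p s)) m₁ s u
  have d2 := fun s u => meanDeviation_nonneg (n := n) hV (outputDensity p κ V) m₂ s u
  have d3 := fun s u => meanDeviation_nonneg (n := n) hV
    (fun s u y => condDensity p κ V s u y) m₃ s u
  have d4 := fun s u => meanDeviation_nonneg (n := n) hW (outputDensity p κ W) m₄ s u
  have d5 := fun s u => meanDeviation_nonneg (n := n) hW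
    (fun s u y => condDensity p κ W s u y) m₅ s u
  have hφ0 : ∀ s u, 0 ≤ φ s u := fun s u => by
    simp only [φ]; linarith [d1 s u, d2 s u, d3 s u, d4 s u, d5 s u]
  have hφD : ∀ s u, φ s u ≤ n * D := fun s u => by
    have h1 := meanDeviation_le hV hV1 hC₁ s u
    have h2 := meanDeviation_le hV hV1 hC₂ s u
    have h3 := meanDeviation_le hV hV1 hC₃ s u
    have h4 := meanDeviation_le hW hW1 hC₄ s u
    have h5 := meanDeviation_le hW hW1 hC₅ s u
    have h6 : C ≤ D := by
      have := abs_nonneg A; have := abs_nonneg LY; have := abs_nonneg LZ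
      have := abs_nonneg m₄; have := abs_nonneg m₅
      linarith
    have h7 := mul_le_mul_of_nonneg_left h6 hn0.le
    have h8 : n * C = n * C₁ + n * C₂ + n * C₃ + n * C₄ + n * C₅ := by rw [hC]; ring
    simp only [φ]; linarith
  have hφmean : ∑ s, ∑ u, tensor p s * tensor₂ κ s u * φ s u ≤ C * Real.sqrt n := by
    have h1 := mean_deviation_le hp hp1 hκ hκ1 hV hV1 hC₁0 hC₁ n
    have h2 := mean_deviation_le hp hp1 hκ hκ1 hV hV1 hC₂0 hC₂ n
    have h3 := mean_deviation_le hp hp1 hκ hκ1 hV hV1 hC₃0 hC₃ n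
    have h4 := mean_deviation_le hp hp1 hκ hκ1 hW hW1 hC₄0 hC₄ n
    have h5 := mean_deviation_le hp hp1 hκ hκ1 hW hW1 hC₅0 hC₅ n
    simp only [φ, mul_add, Finset.sum_add_distrib]
    simp only [meanDeviation]
    have h8 : C * Real.sqrt n = C₁ * Real.sqrt n + C₂ * Real.sqrt n + C₃ * Real.sqrt n +
      C₄ * Real.sqrt n + C₅ * Real.sqrt n := by rw [hC]; ring
    linarith
  have tp0 := tensor_nonneg (n := n) hp
  have tp1 := sum_tensor (n := n) hp1
  have tκ0 := tensor₂_nonneg (n := n) hκ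
  have tκ1 := sum_tensor₂ (n := n) hκ1
  have tV0 := tensor₃_nonneg (n := n) hV
  have tV1 := sum_tensor₃ (n := n) hV1
  have tW0 := tensor₃_nonneg (n := n) hW
  have tW1 := sum_tensor₃ (n := n) hW1
  classical
  obtain ⟨c, τ, hpos, hX⟩ := exists_code tp0 tp1 tκ0 tκ1 tV0 tV1 hM2 N φ hφ0 hφD
    (by positivity : 0 ≤ n * D)
  have htyp := one_sub_typicalMass_le hp hp1 hκ hκ1 hV hV1 hR hC₆0
    (by rw [hmU]; exact hC₆) (δ := δ) (n := n) (by linarith)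
  rw [hmU, ← hM] at htyp
  have hexp := exp_neg_div_le hM0 (by linarith : 0 < n * δ) hNlow
  set X := ∑ s, tensor p s * (τ s).elim (n * D) (fun t => φ s (c t) + ∑ y, tensor₃ V s (c t) y /
        outputBound (tensor p) (tensor₂ κ) (tensor₃ V) M N s (c t) y *
          codeOutput (tensor p) (tensor₂ κ) (tensor₃ V) c τ y)
  have hXK : X ≤ K * (Real.sqrt n + 1) := by
    have hs := Real.sqrt_nonneg (n : ℝ)
    have h1 : (2 * (C₆ * Real.sqrt n / (n * δ)) + 2 / (n * δ)) * (n * D) =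
        2 * C₆ * D / δ * Real.sqrt n + 2 * D / δ := by
      field_simp
    have h2 : (2 * (1 - ∑ s, tensor p s * typicalMass (tensor p) (tensor₂ κ) M s) +
        Real.exp (-(N / M))) * (n * D) ≤
        (2 * (C₆ * Real.sqrt n / (n * δ)) + 2 / (n * δ)) * (n * D) :=
      mul_le_mul_of_nonneg_right (by linarith) (by positivity)
    rw [h1] at h2
    have h3 : K * (Real.sqrt n + 1) = C * Real.sqrt n + 2 * C₆ * D / δ * Real.sqrt n +
        2 * D / δ + 1 + ((2 * D / δ + 1) * Real.sqrt n + (C + 2 * C₆ * D / δ)) := by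
      rw [hK]; ring
    have h4 : 0 ≤ (2 * D / δ + 1) * Real.sqrt n + (C + 2 * C₆ * D / δ) := by positivity
    linarith
  have hφX : ∑ s, tensor p s * (τ s).elim (n * D) (fun t => φ s (c t)) ≤ X := by
    refine Finset.sum_le_sum fun s _ => mul_le_mul_of_nonneg_left ?_ (tp0 s)
    cases τ s with
    | none => simp
    | some t =>
      simp only [Option.elim_some, le_add_iff_nonneg_right]
      refine Finset.sum_nonneg fun y _ => mul_nonneg (div_nonneg (tV0 _ _ _) ?_)
        (Finset.sum_nonneg fun s _ => mul_nonneg (tp0 s) (codeKernel_nonneg tκ0 tV0 c τ s y))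
      obtain ⟨h1, h2⟩ := codebookOutput_terms_nonneg tp0 tκ0 tV0 y
      have h3 := h1 (c t)
      have h4 := tp0 s
      have h5 := tV0 s (c t) y
      unfold outputBound
      rw [mul_comm M, ← div_div]
      positivity
  have habs : ∀ r : ℝ, n * r ≤ n * |r| := fun r => mul_le_mul_of_nonneg_left (le_abs_self r) hn0.le
  have habs' : ∀ r : ℝ, -(n * r) ≤ n * |r| := fun r => by
    have := mul_le_mul_of_nonneg_left (neg_abs_le r) hn0.le
    linarith
  have habs0 : ∀ r : ℝ, 0 ≤ n * |r| := fun r => by positivity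
  have hnD : n * D = n * C + n * |A| + n * |LY| + n * |LZ| + n * |m₄| + n * |m₅| := by
    rw [hD]; ring
  have hnC : 0 ≤ n * C := by positivity
  refine ⟨N, c, τ, ?_, ?_, ?_⟩
  · have hlow := le_channelInfo_code tp0 tp1 tκ0 tκ1 tV0 tV1 hM0 c τ
      (fun s u y => deviation (fun s _ _ => Real.logb 2 (p s)) m₁ s u y +
        deviation (outputDensity p κ V) m₂ s u y +
        deviation (fun s u y => condDensity p κ V s u y) m₃ s u y) φ
      (A := n * A - n * δ - 3) (B := n * D) (L := n * LY) (by
        have := habs A; have := habs LY; have := habs0 LZ; have := habs0 m₄; have := habs0 m₅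
        linarith) (by positivity) hφ0 (by
        intro s u
        simp only [mul_add, Finset.sum_add_distrib, φ]
        have := d4 s u; have := d5 s u
        simp only [meanDeviation] at *
        linarith) (by
        intro s t y hs hst hv
        have hk := hpos s t hst
        have g1 := le_abs_self (∑ i, Real.logb 2 (p (s i)) - n * m₁)
        have g2 := neg_abs_le (∑ i, outputDensity p κ V (s i) (c t i) (y i) - n * m₂)
        have g3 := neg_abs_le (∑ i, condDensity p κ V (s i) (c t i) (y i) - n * m₃)
        have q1 := abs_nonneg (∑ i, Real.logb 2 (p (s i)) - n * m₁)
        have q2 := abs_nonneg (∑ i, outputDensity p κ V (s i) (c t i) (y i) - n * m₂)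
        have q3 := abs_nonneg (∑ i, condDensity p κ V (s i) (c t i) (y i) - n * m₃)
        have f1 := mul_le_mul_of_nonneg_left hA1 hn0.le
        have f2 := mul_le_mul_of_nonneg_left hA2 hn0.le
        have f3 := mul_le_mul_of_nonneg_left hA3 hn0.le
        have hnd : 0 ≤ n * δ := by positivity
        simp only [deviation]
        refine logb_outputBound_le hp hκ hV (A := n * A) (x := n * δ) hM0 hnd ?_ hs hk hv ?_ ?_ ?_
        · linarith
        · linarith
        · linarith
        · rw [hlogM]; linarith) (by
        intro s y hs hk
        exact (abs_logb_sum_tensor_le hp hκ hV (fun s y => hLY (s, y)) hs hk).2.1)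
    have hnd : 0 ≤ n * δ := by positivity
    linarith
  -- The product output law as reference gives the bound I(U,S;Z).
  · have hup := channelInfo_code_le tp0 tp1 tκ0 tκ1 tW0 tW1 c τ
      (outputLaw (tensor p) (tensor₂ κ) (tensor₃ W))
      (fun y => (codebookOutput_terms_nonneg tp0 tκ0 tW0 y).2) (sum_outputLaw tp1 tκ1 tW1).le
      (fun s u y => deviation (outputDensity p κ W) m₄ s u y) φ
      (A := n * m₄) (B := n * D) (L := n * LZ) (by
        have := habs LZ; have := habs' m₄; have := habs0 A; have := habs0 LY; have := habs0 m₅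
        linarith) (by
        intro s u
        have := d1 s u; have := d2 s u; have := d3 s u; have := d5 s u
        simp only [φ]
        simp only [meanDeviation] at *
        linarith) (by
        intro s t y hs hst hv
        obtain ⟨g1, g2⟩ := logb_tensor₃_sub_outputLaw hp hκ hW hs (hpos s t hst) hv
        refine ⟨g1, ?_⟩
        rw [g2]
        have := le_abs_self (∑ i, outputDensity p κ W (s i) (c t i) (y i) - n * m₄)
        simp only [deviation]
        linarith) (by
        intro s y hs hk
        have := abs_logb_sum_tensor_le hp hκ hW (fun s y => hLZ (s, y)) hs hk
        exact ⟨this.1, this.2.2⟩)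
    have : 0 ≤ K * (Real.sqrt n + 1) := by positivity
    linarith
  · have hN1 : (0 : ℝ) < N + 1 := by positivity
    -- The codebook mixture as reference: log₂(N + 1) supplies I(U;S) + R, and the density supplies
    -- I(S;Z|U).
    have hup := channelInfo_code_le tp0 tp1 tκ0 tκ1 tW0 tW1 c τ
      (codebookOutput (tensor p) (tensor₂ κ) (tensor₃ W) c)
      (fun y => by
        obtain ⟨h1, h2⟩ := codebookOutput_terms_nonneg tp0 tκ0 tW0 y
        exact div_nonneg (add_nonneg (Finset.sum_nonneg fun t _ => h1 _) h2) hN1.le)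
      (sum_codebookOutput_le tp1 tκ1 tW1 c)
      (fun s u y => deviation (fun s u y => condDensity p κ W s u y) m₅ s u y) φ
      (A := Real.logb 2 (N + 1) + n * m₅) (B := n * D) (L := Real.logb 2 (N + 1) + n * LZ) (by
        have := habs LZ; have := habs' m₅; have := habs0 A; have := habs0 LY; have := habs0 m₄
        linarith) (by
        intro s u
        have := d1 s u; have := d2 s u; have := d3 s u; have := d4 s u
        simp only [φ]
        simp only [meanDeviation] at *
        linarith) (by
        intro s t y hs hst hv
        obtain ⟨g1, g2, g3⟩ := logb_tensor₃_sub_cond hp hκ hW hs (hpos s t hst) hv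
        obtain ⟨h1, h2⟩ := codebookOutput_terms_nonneg tp0 tκ0 tW0 y
        have hq := logb_sub_codebookOutput_le (N := N) (v := tensor₃ W s (c t) y)
          (q := codebookOutput (tensor p) (tensor₂ κ) (tensor₃ W) c y) (div_pos g1 g2) (by
            unfold codebookOutput
            gcongr
            have := Finset.single_le_sum (fun t _ => h1 (c t)) (Finset.mem_univ t)
            linarith)
        refine ⟨hq.1, hq.2.trans ?_⟩
        rw [Real.logb_div g1.ne' g2.ne']
        have := le_abs_self (∑ i, condDensity p κ W (s i) (c t i) (y i) - n * m₅)
        simp only [deviation]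
        linarith) (by
        intro s y hs hk
        have hb := abs_logb_sum_tensor_le hp hκ hW (fun s y => hLZ (s, y)) hs hk
        obtain ⟨h1, h2⟩ := codebookOutput_terms_nonneg tp0 tκ0 tW0 y
        have hq := logb_sub_codebookOutput_le (N := N)
          (v := ∑ u, tensor₂ κ s u * tensor₃ W s u y)
          (q := codebookOutput (tensor p) (tensor₂ κ) (tensor₃ W) c y) hb.1 (by
            unfold codebookOutput
            gcongr
            have := Finset.sum_nonneg fun t (_ : t ∈ Finset.univ) => h1 (c t)
            linarith)
        exact ⟨hq.1, hq.2.trans (by linarith [hb.2.2])⟩)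
    have : 0 ≤ K * (Real.sqrt n + 1) := by positivity
    linarith

end BlockCode

/-! ### Finite laws, disintegration and entropy -/

section FiniteLaws

variable {Ω A B : Type*}

theorem toReal_map_apply [Fintype A] [DecidableEq B] (r : PMF A) (f : A → B) (b : B) :
    (r.map f b).toReal = ∑ a, if f a = b then (r a).toReal else 0 := by
  rw [PMF.map_apply, tsum_fintype, ENNReal.toReal_sum]
  · refine Finset.sum_congr rfl fun a _ => ?_
    by_cases h : f a = b
    · simp [h]
    · simp [h, Ne.symm h]
  · intro a _
    split_ifs
    · exact PMF.apply_ne_top _ _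
    · exact ENNReal.zero_ne_top

theorem toReal_bind_apply [Fintype A] (r : PMF A) (K : A → PMF B) (b : B) :
    (r.bind K b).toReal = ∑ a, (r a).toReal * (K a b).toReal := by
  rw [PMF.bind_apply, tsum_fintype, ENNReal.toReal_sum]
  · simp only [ENNReal.toReal_mul]
  · intro a _
    exact ENNReal.mul_ne_top (PMF.apply_ne_top _ _) (PMF.apply_ne_top _ _)

theorem sum_toReal [Fintype A] (r : PMF A) : ∑ a, (r a).toReal = 1 := by
  rw [← ENNReal.toReal_sum fun a _ => PMF.apply_ne_top _ _, ← tsum_fintype (L := .unconditional A),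
    r.tsum_coe, ENNReal.toReal_one]

theorem toReal_bind_map_mk_apply [Fintype A] (r : PMF A) (K : A → PMF B) (a : A) (b : B) :
    ((r.bind fun a => (K a).map (Prod.mk a)) (a, b)).toReal = (r a).toReal * (K a b).toReal := by
  classical
  rw [toReal_bind_apply, Finset.sum_eq_single a]
  · congr 2
    rw [PMF.map_apply, tsum_eq_single b]
    · simp
    · intro b' hb'; simp [Ne.symm hb']
  · intro a' _ ha'
    rw [PMF.map_apply]
    simp [Ne.symm ha']
  · simp

theorem exists_conditional_law [Fintype A] [Fintype B] (r : PMF (A × B)) :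
    ∃ e : A → PMF B, ∀ a b, (r (a, b)).toReal = (r.map Prod.fst a).toReal * (e a b).toReal := by
  classical
  have hm : ∀ a, r.map Prod.fst a = ∑ b, r (a, b) := fun a => by
    rw [PMF.map_apply, tsum_fintype, Fintype.sum_prod_type, Finset.sum_eq_single a]
    · simp
    · intro a' _ ha'; simp [Ne.symm ha']
    · simp
  -- On null atoms the conditional law is arbitrary; the second marginal serves as a default.
  refine ⟨fun a => if h : r.map Prod.fst a = 0 then r.map Prod.snd else
    PMF.normalize (fun b => r (a, b)) (by rw [tsum_fintype, ← hm]; exact h)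
      (by rw [tsum_fintype, ← hm]; exact PMF.apply_ne_top _ _), fun a b => ?_⟩
  rw [← ENNReal.toReal_mul]
  congr 1
  beta_reduce
  split_ifs with h
  · rw [h, zero_mul]
    rw [hm, Finset.sum_eq_zero_iff] at h
    exact h b (Finset.mem_univ b)
  · rw [PMF.normalize_apply, tsum_fintype, ← hm, mul_comm (r (a, b)), ← mul_assoc,
      ENNReal.mul_inv_cancel h (PMF.apply_ne_top _ _), one_mul]

theorem productLaw_apply {n : ℕ} [Fintype A] (p : Fin n → PMF A) (a : Fin n → A) :
    productLaw p a = ∏ i, p i (a i) := rfl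

theorem productLaw_map {n : ℕ} [Fintype A] [Fintype B] (p : Fin n → PMF A) (g : A → B) :
    (productLaw p).map (fun a i => g (a i)) = productLaw fun i => (p i).map g := by
  classical
  ext b
  rw [PMF.map_apply, tsum_fintype, productLaw_apply]
  simp only [PMF.map_apply, tsum_fintype, productLaw_apply]
  rw [Fintype.prod_sum]
  refine Finset.sum_congr rfl fun a _ => ?_
  by_cases h : b = fun i => g (a i)
  · rw [if_pos h]
    exact Finset.prod_congr rfl fun i _ => by rw [if_pos (congrFun h i)]
  · rw [if_neg h]
    obtain ⟨i, hi⟩ := not_forall.1 fun h' => h (funext h')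
    exact (Finset.prod_eq_zero (Finset.mem_univ i) (if_neg hi)).symm

theorem productLaw_bind {n : ℕ} [Fintype A] [Fintype B] (p : Fin n → PMF A)
    (K : Fin n → A → PMF B) :
    ((productLaw p).bind fun a => productLaw fun i => K i (a i)) =
      productLaw fun i => (p i).bind (K i) := by
  classical
  ext b
  rw [PMF.bind_apply, tsum_fintype, productLaw_apply]
  simp only [PMF.bind_apply, tsum_fintype, productLaw_apply, ← Finset.prod_mul_distrib]
  rw [Fintype.prod_sum]

theorem toReal_productLaw {n : ℕ} [Fintype A] (p : Fin n → PMF A) (a : Fin n → A) :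
    (productLaw p a).toReal = ∏ i, (p i (a i)).toReal := by
  rw [productLaw_apply, ENNReal.toReal_prod]

theorem mutualInfo_eq_channelInfo [Fintype A] [Fintype B] (P : PMF Ω) (X : Ω → A) (Y : Ω → B)
    (p : A → ℝ) (K : A → B → ℝ) (hK1 : ∀ a, ∑ b, K a b = 1)
    (hJ : ∀ a b, (P.map (fun ω => (X ω, Y ω)) (a, b)).toReal = p a * K a b) :
    mutualInfo P X Y = channelInfo p K := by
  classical
  have hX : ∀ a, (P.map X a).toReal = p a := fun a => by
    have : P.map X = (P.map fun ω => (X ω, Y ω)).map Prod.fst := by rw [PMF.map_comp]; rfl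
    rw [this, toReal_map_apply, Fintype.sum_prod_type]
    simp only [hJ]
    rw [Finset.sum_comm]
    simp [← Finset.mul_sum, hK1]
  have hY : ∀ b, (P.map Y b).toReal = ∑ a, p a * K a b := fun b => by
    have : P.map Y = (P.map fun ω => (X ω, Y ω)).map Prod.snd := by rw [PMF.map_comp]; rfl
    rw [this, toReal_map_apply, Fintype.sum_prod_type]
    simp only [hJ]
    simp
  have h1 : ∀ a b, p a * K a b * Real.logb 2 (p a * K a b) =
      p a * Real.logb 2 (p a) * K a b + p a * (K a b * Real.logb 2 (K a b)) := fun a b => by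
    by_cases ha : p a = 0
    · simp [ha]
    by_cases hb : K a b = 0
    · simp [hb]
    rw [Real.logb_mul ha hb]; ring
  have h2 : ∑ x : A × B, p x.1 * K x.1 x.2 * Real.logb 2 (p x.1 * K x.1 x.2) =
      ∑ a, p a * Real.logb 2 (p a) + ∑ a, p a * ∑ b, K a b * Real.logb 2 (K a b) := by
    rw [Fintype.sum_prod_type]
    simp only [h1, Finset.sum_add_distrib, ← Finset.mul_sum, hK1, mul_one]
  have h3 : ∑ b, (∑ a, p a * K a b) * Real.logb 2 (∑ a, p a * K a b) =
      ∑ a, p a * ∑ b, K a b * Real.logb 2 (∑ a, p a * K a b) := by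
    simp only [Finset.mul_sum]
    rw [Finset.sum_comm]
    refine Finset.sum_congr rfl fun b _ => ?_
    rw [Finset.sum_mul]
    simp only [mul_assoc]
  simp only [mutualInfo, entropy, hX, hY, Finset.sum_neg_distrib, channelInfo, mul_sub,
    Finset.sum_sub_distrib]
  have h4 : ∑ x : A × B, (P.map (fun ω => (X ω, Y ω)) x).toReal *
      Real.logb 2 (P.map (fun ω => (X ω, Y ω)) x).toReal =
      ∑ x : A × B, p x.1 * K x.1 x.2 * Real.logb 2 (p x.1 * K x.1 x.2) :=
    Finset.sum_congr rfl fun x _ => by rw [← hJ]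
  rw [h4, h2, h3]
  ring

/-- Regrouping over the finer variable T turns every entropy into a mean under one joint law, so
that they combine linearly. -/
theorem entropy_comp [Fintype A] [Fintype B] (P : PMF Ω) (T : Ω → A) (f : A → B) :
    entropy P (fun ω => f (T ω)) =
      -∑ a, (P.map T a).toReal * Real.logb 2 (P.map (fun ω => f (T ω)) (f a)).toReal := by
  classical
  have h : P.map (fun ω => f (T ω)) = (P.map T).map f := by rw [PMF.map_comp]; rfl
  rw [entropy, Finset.sum_neg_distrib]
  congr 1
  have : ∀ b, (P.map (fun ω => f (T ω)) b).toReal *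
      Real.logb 2 (P.map (fun ω => f (T ω)) b).toReal =
      ∑ a, if f a = b then (P.map T a).toReal *
        Real.logb 2 (P.map (fun ω => f (T ω)) (f a)).toReal else 0 := by
    intro b
    nth_rewrite 1 [h]
    rw [toReal_map_apply, Finset.sum_mul]
    refine Finset.sum_congr rfl fun a _ => ?_
    split_ifs with hb
    · rw [hb]
    · rw [zero_mul]
  simp only [this]
  rw [Finset.sum_comm]
  simp

end FiniteLaws

/-! ### Single-letter quantities as mean densities -/

section SingleLetter

variable {Ω S U B : Type*} [Fintype S] [Fintype U] [Fintype B]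
  {p : S → ℝ} {κ : S → U → ℝ} {V : S → U → B → ℝ}

theorem jointMean_congr (hp : ∀ s, 0 ≤ p s) (hκ : ∀ s u, 0 ≤ κ s u) (hV : ∀ s u b, 0 ≤ V s u b)
    {f g : S → U → B → ℝ}
    (h : ∀ s u b, 0 < p s → 0 < κ s u → 0 < V s u b → f s u b = g s u b) :
    jointMean p κ V f = jointMean p κ V g := by
  refine Finset.sum_congr rfl fun s _ => Finset.sum_congr rfl fun u _ =>
    Finset.sum_congr rfl fun b _ => ?_
  rcases (hp s).eq_or_lt with h1 | h1
  · simp [← h1]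
  rcases (hκ s u).eq_or_lt with h2 | h2
  · simp [← h2]
  rcases (hV s u b).eq_or_lt with h3 | h3
  · simp [← h3]
  rw [h s u b h1 h2 h3]

theorem jointMean_add (f g : S → U → B → ℝ) :
    jointMean p κ V (fun s u b => f s u b + g s u b) = jointMean p κ V f + jointMean p κ V g := by
  simp only [jointMean, mul_add, Finset.sum_add_distrib]

theorem jointMean_sub (f g : S → U → B → ℝ) :
    jointMean p κ V (fun s u b => f s u b - g s u b) = jointMean p κ V f - jointMean p κ V g := by
  simp only [jointMean, mul_sub, Finset.sum_sub_distrib]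

/-- This mean is I(U;S), an average of divergences of κ(s,·) from the input law. Its sign ensures M
≥ 2 in the block code. -/
theorem jointMean_inputDensity_nonneg (hp : ∀ s, 0 ≤ p s) (hp1 : ∑ s, p s = 1)
    (hκ : ∀ s u, 0 ≤ κ s u) (hκ1 : ∀ s, ∑ u, κ s u = 1) (hV1 : ∀ s u, ∑ b, V s u b = 1) :
    0 ≤ jointMean p κ V (fun s u _ => inputDensity p κ s u) := by
  have e : jointMean p κ V (fun s u _ => inputDensity p κ s u) =
      ∑ s, p s * ∑ u, κ s u * inputDensity p κ s u := by
    simp only [jointMean, ← Finset.sum_mul, ← Finset.mul_sum, hV1, mul_one]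
    simp only [mul_assoc, Finset.mul_sum]
  rw [e]
  refine Finset.sum_nonneg fun s _ => ?_
  rcases (hp s).eq_or_lt with h | h
  · simp [← h]
  refine mul_nonneg h.le ?_
  have := gibbs_inequality (κ s) (inputLaw p κ) (hκ s) (inputLaw_nonneg p κ hp hκ) (hκ1 s)
    (sum_inputLaw p κ hp1 hκ1).le (fun u hu => inputLaw_pos hp hκ h hu)
  simp only [inputDensity, mul_sub, Finset.sum_sub_distrib]
  linarith

theorem entropy_eq_neg_jointMean {C : Type*} [Fintype C] [DecidableEq C] (P : PMF Ω) (s : Ω → S)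
    (u : Ω → U) (b : Ω → B)
    (hJ : ∀ x y z, (P.map (fun ω => (s ω, u ω, b ω)) (x, y, z)).toReal = p x * κ x y * V x y z)
    (f : S × U × B → C) (r : S → U → B → ℝ)
    (hr : ∀ x y z, (∑ x', ∑ y', ∑ z', if f (x', y', z') = f (x, y, z) then
        p x' * κ x' y' * V x' y' z' else 0) = r x y z) :
    entropy P (fun ω => f (s ω, u ω, b ω)) =
      -jointMean p κ V (fun x y z => Real.logb 2 (r x y z)) := by
  rw [entropy_comp P (fun ω => (s ω, u ω, b ω)) f, Fintype.sum_prod_type]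
  simp only [Fintype.sum_prod_type, hJ, jointMean]
  congr 1
  refine Finset.sum_congr rfl fun x _ => Finset.sum_congr rfl fun y _ =>
    Finset.sum_congr rfl fun z _ => ?_
  have h : P.map (fun ω => f (s ω, u ω, b ω)) = (P.map fun ω => (s ω, u ω, b ω)).map f := by
    rw [PMF.map_comp]; rfl
  rw [h, toReal_map_apply, Fintype.sum_prod_type]
  simp only [Fintype.sum_prod_type, hJ]
  rw [hr]

/-- The single-letter information quantities as means of information densities. -/
theorem information_eq_jointMean (hp : ∀ s, 0 ≤ p s)
    (hκ : ∀ s u, 0 ≤ κ s u) (hκ1 : ∀ s, ∑ u, κ s u = 1) (hV : ∀ s u b, 0 ≤ V s u b)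
    (hV1 : ∀ s u, ∑ b, V s u b = 1) (P : PMF Ω) (s : Ω → S) (u : Ω → U) (b : Ω → B)
    (hJ : ∀ x y z, (P.map (fun ω => (s ω, u ω, b ω)) (x, y, z)).toReal = p x * κ x y * V x y z) :
    mutualInfo P s (fun ω => (b ω, u ω)) =
      jointMean p κ V (fun s u _ => inputDensity p κ s u) +
      jointMean p κ V (fun s u b => condDensity p κ V s u b) ∧
    mutualInfo P u s = jointMean p κ V (fun s u _ => inputDensity p κ s u) ∧
    mutualInfo P (fun ω => (u ω, s ω)) b = jointMean p κ V (outputDensity p κ V) ∧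
    mutualInfo P u b = jointMean p κ V (outputDensity p κ V) -
      jointMean p κ V (fun s u b => condDensity p κ V s u b) ∧
    condEntropy P s (fun ω => (b ω, u ω)) =
      -jointMean p κ V (fun s _ _ => Real.logb 2 (p s)) -
      jointMean p κ V (fun s u _ => inputDensity p κ s u) -
      jointMean p κ V (fun s u b => condDensity p κ V s u b) := by
  classical
  have HS := entropy_eq_neg_jointMean P s u b hJ (fun r => r.1) (fun x _ _ => p x) (fun x y z => by
    rw [Finset.sum_eq_single x (fun x' _ h => by simp [h]) (by simp)]
    simp [← Finset.mul_sum, hV1, hκ1])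
  have HU := entropy_eq_neg_jointMean P s u b hJ (fun r => r.2.1) (fun _ y _ => inputLaw p κ y) (fun x y z => by
    refine Finset.sum_congr rfl fun x' _ => ?_
    rw [Finset.sum_eq_single y (fun y' _ h => by simp [h]) (by simp)]
    simp [← Finset.mul_sum, hV1])
  have HB := entropy_eq_neg_jointMean P s u b hJ (fun r => r.2.2) (fun _ _ z => outputLaw p κ V z) (fun x y z => by
    simp [outputLaw])
  have HUS := entropy_eq_neg_jointMean P s u b hJ (fun r => (r.2.1, r.1)) (fun x y _ => p x * κ x y) (fun x y z => by
    simp [Prod.ext_iff, ite_and, Finset.sum_ite_irrel, ← Finset.mul_sum, hV1])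
  have HBU := entropy_eq_neg_jointMean P s u b hJ (fun r => (r.2.2, r.2.1)) (fun _ y z => inputOutputLaw p κ V y z)
    (fun x y z => by
      simp [Prod.ext_iff, ite_and, inputOutputLaw])
  have HUB := entropy_eq_neg_jointMean P s u b hJ (fun r => (r.2.1, r.2.2)) (fun _ y z => inputOutputLaw p κ V y z)
    (fun x y z => by
      simp [Prod.ext_iff, ite_and, Finset.sum_ite_irrel, inputOutputLaw])
  have HSBU := entropy_eq_neg_jointMean P s u b hJ (fun r => (r.1, r.2.2, r.2.1)) (fun x y z => p x * κ x y * V x y z)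
    (fun x y z => by
      simp [Prod.ext_iff, ite_and, Finset.sum_ite_irrel])
  have HUSB := entropy_eq_neg_jointMean P s u b hJ (fun r => ((r.2.1, r.1), r.2.2)) (fun x y z => p x * κ x y * V x y z)
    (fun x y z => by
      simp [Prod.ext_iff, ite_and, Finset.sum_ite_irrel])
  have hlogUS : jointMean p κ V (fun x y _ => Real.logb 2 (p x * κ x y)) =
      jointMean p κ V (fun x _ _ => Real.logb 2 (p x)) +
        jointMean p κ V (fun x y _ => Real.logb 2 (κ x y)) := by
    rw [← jointMean_add]
    exact jointMean_congr hp hκ hV fun x y z h1 h2 h3 => Real.logb_mul h1.ne' h2.ne'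
  have hlogUSB : jointMean p κ V (fun x y z => Real.logb 2 (p x * κ x y * V x y z)) =
      jointMean p κ V (fun x _ _ => Real.logb 2 (p x)) +
        jointMean p κ V (fun x y _ => Real.logb 2 (κ x y)) +
        jointMean p κ V (fun x y z => Real.logb 2 (V x y z)) := by
    rw [← hlogUS, ← jointMean_add]
    exact jointMean_congr hp hκ hV fun x y z h1 h2 h3 =>
      Real.logb_mul (mul_pos h1 h2).ne' h3.ne'
  have hI : jointMean p κ V (fun s u _ => inputDensity p κ s u) =
      jointMean p κ V (fun x y _ => Real.logb 2 (κ x y)) -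
        jointMean p κ V (fun _ y _ => Real.logb 2 (inputLaw p κ y)) := by
    rw [← jointMean_sub]; rfl
  have hO : jointMean p κ V (outputDensity p κ V) =
      jointMean p κ V (fun x y z => Real.logb 2 (V x y z)) -
        jointMean p κ V (fun _ _ z => Real.logb 2 (outputLaw p κ V z)) := by
    rw [← jointMean_sub]; rfl
  have hC : jointMean p κ V (fun s u b => condDensity p κ V s u b) =
      jointMean p κ V (fun x y z => Real.logb 2 (V x y z)) +
        jointMean p κ V (fun _ y _ => Real.logb 2 (inputLaw p κ y)) -
        jointMean p κ V (fun _ y z => Real.logb 2 (inputOutputLaw p κ V y z)) := by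
    rw [← jointMean_add, ← jointMean_sub]; rfl
  simp only [mutualInfo, condEntropy]
  rw [hI, hO, hC]
  refine ⟨?_, ?_, ?_, ?_, ?_⟩
  · linarith
  · linarith
  · linarith
  · linarith
  · linarith

end SingleLetter

/-! ### From the block channel to real kernels -/

section Bridge

variable {S U X Y Z B : Type*}

theorem exists_disintegration [Fintype U] [Fintype X] (r : PMF (U × X)) :
    ∃ e : U → PMF X, r = (r.map Prod.fst).bind fun a => (e a).map (Prod.mk a) := by
  obtain ⟨e, he⟩ := exists_conditional_law r
  refine ⟨e, PMF.ext fun ⟨a, b⟩ => ?_⟩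
  rw [← ENNReal.toReal_eq_toReal_iff' (PMF.apply_ne_top _ _) (PMF.apply_ne_top _ _), he,
    toReal_bind_map_mk_apply]

/-- Law of the output letter `g (Y, Z)` when the channel input has law `e`. -/
def letterKernel (W : X → S → PMF (Y × Z)) (g : Y × Z → B) (s : S) (e : PMF X) : PMF B :=
  e.bind fun x => (W x s).map g

/-- Given the state tuple, the encoder emits independent letters, so the memoryless channel keeps a
product form. The map g selects a receiver. -/
theorem toReal_map_blockLaw [Fintype S] [Fintype X] [Fintype Y] [Fintype Z] [Fintype B] (pS : PMF S) (W : X → S → PMF (Y × Z)) (g : Y × Z → B) {n : ℕ}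
    (E : (Fin n → S) → Fin n → PMF X) (b : Blocks n S X Y Z → Fin n → B)
    (hb : ∀ s x (yz : Fin n → Y × Z),
      b ⟨s, x, fun i => (yz i).1, fun i => (yz i).2⟩ = fun i => g (yz i))
    (s : Fin n → S) (y : Fin n → B) :
    ((blockLaw pS W fun s => productLaw (E s)).map (fun ω => (ω.s, b ω)) (s, y)).toReal =
      (∏ i, (pS (s i)).toReal) * ∏ i, (letterKernel W g (s i) (E s i) (y i)).toReal := by
  have h : (blockLaw pS W fun s => productLaw (E s)).map (fun ω => (ω.s, b ω)) =
      (productLaw fun _ : Fin n => pS).bind fun s =>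
        (productLaw fun i => letterKernel W g (s i) (E s i)).map (Prod.mk s) := by
    simp only [blockLaw, PMF.map_bind, PMF.map_comp]
    congr 1
    funext s
    simp only [letterKernel]
    rw [← productLaw_bind (E s) (fun i x => (W x (s i)).map g), PMF.map_bind]
    congr 1
    funext x
    rw [← productLaw_map, PMF.map_comp]
    congr 1
    funext yz
    simp only [Function.comp]
    rw [hb]
  rw [h, toReal_bind_map_mk_apply, toReal_productLaw, toReal_productLaw]

theorem toReal_map_singleLetterLaw [Fintype S] [Fintype U] (pS : PMF S) (W : X → S → PMF (Y × Z))
    (q : S → PMF (U × X))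
    (e : S → U → PMF X) (he : ∀ s, q s = ((q s).map Prod.fst).bind fun a => (e s a).map (Prod.mk a))
    (g : Y × Z → B) (b : Letters S U X Y Z → B) (hb : ∀ s u x yz, b ⟨s, u, x, yz.1, yz.2⟩ = g yz)
    (s : S) (u : U) (y : B) :
    ((singleLetterLaw pS W q).map (fun ω => (ω.s, ω.u, b ω)) (s, u, y)).toReal =
      (pS s).toReal * ((q s).map Prod.fst u).toReal * (letterKernel W g s (e s u) y).toReal := by
  have h : (singleLetterLaw pS W q).map (fun ω => (ω.s, ω.u, b ω)) =
      pS.bind fun s => (((q s).map Prod.fst).bind fun u =>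
        (letterKernel W g s (e s u)).map (Prod.mk u)).map (Prod.mk s) := by
    simp only [singleLetterLaw, PMF.map_bind, PMF.map_comp]
    congr 1
    funext s
    conv_lhs => rw [he s]
    rw [PMF.bind_bind]
    congr 1
    funext u
    simp only [letterKernel, PMF.map_bind, PMF.bind_map, PMF.map_comp]
    congr 1
    funext x
    simp only [Function.comp]
    congr 1
    funext yz
    simp only [Function.comp_apply, hb]
  rw [h, toReal_bind_map_mk_apply, toReal_bind_map_mk_apply, mul_assoc]

/-- Law of the input letters for the state tuple `s`: the conditional law given the codeword with
index `τ s`, or the conditional law given the state alone when the encoder fails. -/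
def codeInput (q : S → PMF (U × X)) (e : S → U → PMF X) {n N : ℕ} (c : Fin N → Fin n → U)
    (τ : (Fin n → S) → Option (Fin N)) (s : Fin n → S) (i : Fin n) : PMF X :=
  (τ s).elim (((q (s i)).map Prod.fst).bind (e (s i))) fun t => e (s i) (c t i)

/-- On failure, a product of single-letter mixtures over U equals the mixture over whole codewords,
so independent fresh letters realise the failure branch of `codeKernel`. -/
theorem prod_letterKernel_codeInput [Fintype U] (W : X → S → PMF (Y × Z)) (g : Y × Z → B)
    (q : S → PMF (U × X)) (e : S → U → PMF X) {n N : ℕ} (c : Fin N → Fin n → U)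
    (τ : (Fin n → S) → Option (Fin N)) (s : Fin n → S) (b : Fin n → B) :
    ∏ i, (letterKernel W g (s i) (codeInput q e c τ s i) (b i)).toReal =
      codeKernel (tensor₂ fun s u => ((q s).map Prod.fst u).toReal)
        (tensor₃ fun s u b => (letterKernel W g s (e s u) b).toReal) c τ s b := by
  simp only [codeKernel, codeInput]
  cases τ s with
  | some t => rfl
  | none =>
    simp only [Option.elim_none]
    rw [sum_tensor₂_mul_tensor₃]
    refine Finset.prod_congr rfl fun i _ => ?_
    rw [letterKernel, PMF.bind_bind, toReal_bind_apply]
    rfl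

end Bridge

/-! ### Achievability and passage to the closure -/

theorem exists_nat_sqrt_bound (K : ℝ) {ε : ℝ} (hε : 0 < ε) :
    ∃ N₀ : ℕ, ∀ n : ℕ, N₀ ≤ n → 1 ≤ (n : ℝ) * (ε / 4) ∧
      2 * n * (ε / 4) + 3 + K * (Real.sqrt n + 1) ≤ n * ε := by
  -- Once √n ≥ b ≥ 1, the constants are absorbed into (3 + 2|K|)√n ≤ nε/2; the other half of nε pays
  -- for 2nδ with δ = ε/4.
  set b := 2 * (3 + 2 * |K|) / ε + 1 with hb
  have hb1 : 1 ≤ b := by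
    have : 0 ≤ 2 * (3 + 2 * |K|) / ε := by positivity
    linarith
  refine ⟨max ⌈b ^ 2⌉₊ ⌈4 / ε⌉₊, fun n hn => ?_⟩
  have h1 : b ^ 2 ≤ n := (Nat.le_ceil _).trans (by exact_mod_cast (le_max_left _ _).trans hn)
  have h2 : 4 / ε ≤ n := (Nat.le_ceil _).trans (by exact_mod_cast (le_max_right _ _).trans hn)
  refine ⟨?_, ?_⟩
  · rw [div_le_iff₀ hε] at h2; linarith
  · have h3 : b ≤ Real.sqrt n := Real.le_sqrt_of_sq_le h1
    have h4 : Real.sqrt n * Real.sqrt n = n := Real.mul_self_sqrt (Nat.cast_nonneg n)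
    have h5 : K * (Real.sqrt n + 1) ≤ |K| * (Real.sqrt n + 1) :=
      mul_le_mul_of_nonneg_right (le_abs_self K) (by positivity)
    have h6 : |K| ≤ |K| * Real.sqrt n := le_mul_of_one_le_right (abs_nonneg K) (hb1.trans h3)
    have h7 : b * ε = 2 * (3 + 2 * |K|) + ε := by rw [hb]; field_simp
    have h8 : (3 + 2 * |K|) * Real.sqrt n ≤ n * ε / 2 := by
      have h9 := mul_le_mul_of_nonneg_right h3 (by positivity : 0 ≤ Real.sqrt n * ε)
      have h10 : b * (Real.sqrt n * ε) = (b * ε) * Real.sqrt n := by ring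
      rw [h10, h7, ← mul_assoc, h4] at h9
      have : 0 ≤ ε * Real.sqrt n := by positivity
      linarith
    have h11 : 3 ≤ 3 * Real.sqrt n := by linarith
    linarith

/-- The choice A = R_a is admissible: R_u ≤ I(U;Y) - I(U;S) puts I(S;Y,U) + R_u below I(U,S;Y), and
R_u ≤ H(S|Y,U) puts it below H(S). -/
theorem achievable_of_secureRefinementRates {S U X Y Z : Type*} [Fintype S] [Fintype U] [Fintype X]
    [Fintype Y] [Fintype Z] (pS : PMF S) (W : X → S → PMF (Y × Z)) (q : S → PMF (U × X))
    {Ru Ra Rl : ℝ} (h : SecureRefinementRates (singleLetterLaw pS W q) Ru Ra Rl) :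
    Achievable pS W Ra Rl := by
  choose e he using fun s => exists_disintegration (q s)
  set p : S → ℝ := fun s => (pS s).toReal
  set κ : S → U → ℝ := fun s u => ((q s).map Prod.fst u).toReal
  set V : S → U → Y → ℝ := fun s u y => (letterKernel W Prod.fst s (e s u) y).toReal
  set V' : S → U → Z → ℝ := fun s u z => (letterKernel W Prod.snd s (e s u) z).toReal
  have hp : ∀ s, 0 ≤ p s := fun s => ENNReal.toReal_nonneg
  have hp1 : ∑ s, p s = 1 := sum_toReal pS
  have hκ : ∀ s u, 0 ≤ κ s u := fun s u => ENNReal.toReal_nonneg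
  have hκ1 : ∀ s, ∑ u, κ s u = 1 := fun s => sum_toReal _
  have hV : ∀ s u y, 0 ≤ V s u y := fun s u y => ENNReal.toReal_nonneg
  have hV1 : ∀ s u, ∑ y, V s u y = 1 := fun s u => sum_toReal _
  have hW : ∀ s u z, 0 ≤ V' s u z := fun s u y => ENNReal.toReal_nonneg
  have hW1 : ∀ s u, ∑ z, V' s u z = 1 := fun s u => sum_toReal _
  obtain ⟨hY1, hY2, hY3, hY4, hY5⟩ := information_eq_jointMean hp hκ hκ1 hV hV1
    (singleLetterLaw pS W q) Letters.s Letters.u Letters.y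
    (toReal_map_singleLetterLaw pS W q e he Prod.fst Letters.y fun _ _ _ _ => rfl)
  obtain ⟨hZ1, hZ2, hZ3, hZ4, -⟩ := information_eq_jointMean hp hκ hκ1 hW hW1
    (singleLetterLaw pS W q) Letters.s Letters.u Letters.z
    (toReal_map_singleLetterLaw pS W q e he Prod.snd Letters.z fun _ _ _ _ => rfl)
  have hmU0 := jointMean_inputDensity_nonneg hp hp1 hκ hκ1 hV1
  obtain ⟨hRu, hRa, hRl, hRu'⟩ := h
  obtain ⟨hR1, hR2⟩ := le_min_iff.1 hRu'
  rw [hY4, hY2] at hR1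
  rw [hY5] at hR2
  rw [hY1] at hRa
  have hUU := hZ2.symm.trans hY2
  have hRl' : jointMean p κ V' (outputDensity p κ V') ≤ Rl ∨
      jointMean p κ V (fun s u _ => inputDensity p κ s u) + Ru +
        jointMean p κ V' (fun s u y => condDensity p κ V' s u y) ≤ Rl := by
    rw [hZ3, hZ1, hZ4, hZ2, hUU] at hRl
    rcases min_le_iff.1 hRl with h1 | h1
    · exact Or.inl h1
    · rcases min_cases Ru (max (jointMean p κ V' (outputDensity p κ V') -
        jointMean p κ V' (fun s u b => condDensity p κ V' s u b) -
        jointMean p κ V (fun s u _ => inputDensity p κ s u)) 0) with h2 | h2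
      · right; linarith
      -- The positive part attains the minimum and is at least I(U;Z) - I(U;S); adding I(S;Z,U)
      -- gives at least I(U,S;Z).
      · left
        have := le_max_left (jointMean p κ V' (outputDensity p κ V') -
          jointMean p κ V' (fun s u b => condDensity p κ V' s u b) -
          jointMean p κ V (fun s u _ => inputDensity p κ s u)) 0
        linarith
  intro ε hε
  obtain ⟨K, hK⟩ := exists_code_bounds (A := Ra) hp hp1 hκ hκ1 hV hV1 hW hW1 hRu
    (by positivity : 0 < ε / 4) rfl hmU0 (by linarith) (by linarith) (by linarith)
  obtain ⟨N₀, hN₀⟩ := exists_nat_sqrt_bound K hε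
  refine ⟨N₀, fun n hn => ?_⟩
  obtain ⟨hn1, hn2⟩ := hN₀ n hn
  obtain ⟨N, c, τ, hlow, hup1, hup2⟩ := hK n hn1
  have hn0 : (0 : ℝ) < n := by
    rcases (Nat.cast_nonneg n : (0 : ℝ) ≤ n).eq_or_lt with h | h
    · rw [← h] at hn1; norm_num at hn1
    · exact h
  have hIY := mutualInfo_eq_channelInfo (blockLaw pS W fun s => productLaw (codeInput q e c τ s)) Blocks.s Blocks.y
    (tensor p) (codeKernel (tensor₂ κ) (tensor₃ V) c τ)
    (sum_codeKernel (sum_tensor₂ hκ1) (sum_tensor₃ hV1) c τ) (fun s y => by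
      rw [toReal_map_blockLaw pS W Prod.fst (codeInput q e c τ) Blocks.y (fun _ _ _ => rfl), prod_letterKernel_codeInput]
      rfl)
  have hIZ := mutualInfo_eq_channelInfo (blockLaw pS W fun s => productLaw (codeInput q e c τ s)) Blocks.s Blocks.z
    (tensor p) (codeKernel (tensor₂ κ) (tensor₃ V') c τ)
    (sum_codeKernel (sum_tensor₂ hκ1) (sum_tensor₃ hW1) c τ) (fun s y => by
      rw [toReal_map_blockLaw pS W Prod.snd (codeInput q e c τ) Blocks.z (fun _ _ _ => rfl), prod_letterKernel_codeInput]
      rfl)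
  refine ⟨fun s => productLaw (codeInput q e c τ s), ?_, ?_⟩
  · rw [hIY, one_div, ← div_eq_inv_mul, le_div_iff₀ hn0]
    linarith
  · rw [hIZ, one_div, ← div_eq_inv_mul, div_le_iff₀ hn0]
    have hnε : 0 ≤ 2 * n * (ε / 4) := by positivity
    rcases hRl' with h1 | h1
    · have := mul_le_mul_of_nonneg_left h1 hn0.le
      linarith
    · have := mul_le_mul_of_nonneg_left h1 hn0.le
      linarith

end

end StateChannel

theorem mainTheorem3 {S X Y Z : Type*} [Fintype S] [Fintype X] [Fintype Y] [Fintype Z]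
    (pS : PMF S) (W : X → S → PMF (Y × Z)) :
    StateChannel.secureRefinementRegion pS W ⊆ StateChannel.tradeoffRegion pS W := by
  intro R hR ε hε
  -- Achievability is a closed condition: half of ε pays for the approximation in the closure, half
  -- for the code.
  obtain ⟨R', ⟨k, q, -, -, Ru, hrates⟩, hdist⟩ := Metric.mem_closure_iff.1 hR (ε / 2) (by positivity)
  obtain ⟨N, hN⟩ := StateChannel.achievable_of_secureRefinementRates pS W q hrates (ε / 2)
    (by positivity)
  rw [Prod.dist_eq, max_lt_iff, Real.dist_eq, Real.dist_eq] at hdist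
  have h1 := (abs_lt.1 hdist.1).2
  have h2 := (abs_lt.1 hdist.2).1
  refine ⟨N, fun n hn => ?_⟩
  obtain ⟨f, hf1, hf2⟩ := hN n hn
  exact ⟨f, by linarith, by linarith⟩
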